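/- Let $n\in\mathbb N$, $\hbar>0$, and let $\mathcal H=L^2(\mathbb R^n)$ carry the Schrödinger representation of position $\vec Q$ (multiplication by the coordinates) and momentum $\vec P=-\mathrm i\hbar\nabla$, so that $[Q_i,P_j]=\mathrm i\hbar\delta_{ij}$, with projection valued measures $\mathsf Q,\mathsf P$ on $\mathbb R^n$, Weyl operators $W(\vec x,\vec p)=\exp\{\frac{\mathrm i}{\hbar}(\vec p\cdot\vec Q-\vec x\cdot\vec P)\}$ and parity operator $(\Pi\psi)(\vec y)=\psi(-\vec y)$. A state is a positive trace class operator of trace $1$. For a state $\rho$ and a positive operator valued measure (POVM) $\mathsf M$, write $\mathsf M_\rho(B)=\mathrm{Tr}\{\rho\,\mathsf M(B)\}$ (so also $\mathsf Q_\rho,\mathsf P_\rho$). Let $\vec a^\rho,A^\rho$ be the mean vector and the variance matrix of $\mathsf Q_\rho$, and $\vec b^\rho,B^\rho$ those of $\mathsf P_\rho$. A state $\rho$ is Gaussian if $$\mathrm{Tr}\{\rho\,W(-\hbar\vec l,\hbar\vec k)\}=\exp\Big\{\mathrm i(\vec k\cdot\vec a+\vec l\cdot\vec b)-\tfrac12(\vec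 k\cdot A\vec k+\vec l\cdot B\vec l)-\vec k\cdot C\vec l\Big\}\qquad\forall\,\vec k,\vec l\in\mathbb R^n$$ for some $\vec a,\vec b\in\mathbb R^n$ and real $n\times n$ matrices $A,B,C$ with $\begin{pmatrix}A&C+\frac{\mathrm i\hbar}{2}\mathbb 1\\ C^T-\frac{\mathrm i\hbar}{2}\mathbb 1&B\end{pmatrix}\ge0$. For a state $\sigma$ let $\mathsf M^\sigma$ be the covariant phase-space observable, i.e. the POVM on $\mathbb R^n\times\mathbb R^n$ given by the weak integrals $$\mathsf M^\sigma(Z)=\frac1{(2\pi\hbar)^n}\int_Z W(\vec x,\vec p)\,\Pi\sigma\Pi\,W(\vec x,\vec p)^*\,\mathrm d\vec x\,\mathrm d\vec p ,$$ and let $\mathsf M^\sigma_1,\mathsf M^\sigma_2$ be its position and momentum marginals. With $\log=\log_2$ and the relative entropy $S(p\|q)=\int f\log\frac fg\in[0,+\infty]$ of probabilities with densities $f,g$, the error function is $S(\rho,\mathsf M^\sigma)=S(\mathsf Q_\rho\|\mathsf M^\sigma_{1,\rho})+S(\mathsf P_\rho\|\mathsf M^\sigma_{2,\rho})$. Put $s(x)=\ln(1+x)-\frac{x}{1+x}$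 for $x\geq 0$. Proposition (error function for the vector Gaussian case). For all Gaussian states $\rho,\sigma$ the error function is finite and has the two equivalent expressions $$S(\rho,\mathsf M^\sigma)=\frac{\log \mathrm e}{2}\Big[\mathrm{Tr}\{s(E)+s(F)\}+\vec a^\sigma\cdot(A^\rho+A^\sigma)^{-1}\vec a^\sigma+\vec b^\sigma\cdot(B^\rho+B^\sigma)^{-1}\vec b^\sigma\Big],$$ $$S(\rho,\mathsf M^\sigma)=\frac{\log \mathrm e}{2}\Big[\mathrm{Tr}\{s(N^{-1})+s(R^{-1})\}+\vec a^\sigma\cdot(A^\rho+A^\sigma)^{-1}\vec a^\sigma+\vec b^\sigma\cdot(B^\rho+B^\sigma)^{-1}\vec b^\sigma\Big],$$ where $$E=(A^\rho)^{-1/2}A^\sigma(A^\rho)^{-1/2},\qquad F=(B^\rho)^{-1/2}B^\sigma(B^\rho)^{-1/2},$$ $$N=(A^\sigma)^{-1/2}A^\rho(A^\sigma)^{-1/2},\qquad R=(B^\sigma)^{-1/2}B^\rho(B^\sigma)^{-1/2}.$$ -/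

import Mathlib

open MeasureTheory
open scoped ENNReal RealInnerProductSpace

noncomputable section

namespace QMeas

section Hilbert

variable {H : Type*} [NormedAddCommGroup H] [InnerProductSpace ℂ H] [CompleteSpace H]

/-- Index set of an (arbitrarily chosen) orthonormal Hilbert basis of `H`. -/
def basisIndex (H : Type*) [NormedAddCommGroup H] [InnerProductSpace ℂ H] [CompleteSpace H] :
    Set H := (exists_hilbertBasis ℂ H).choose

/-- An arbitrarily chosen orthonormal Hilbert basis of `H`. -/
def basis (H : Type*) [NormedAddCommGroup H] [InnerProductSpace ℂ H] [CompleteSpace H] :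
    HilbertBasis (basisIndex H) ℂ H := (exists_hilbertBasis ℂ H).choose_spec.choose

/-- The trace `Tr T = ∑ᵢ ⟪bᵢ, T bᵢ⟫`. For a trace class operator the series converges absolutely
and its sum does not depend on the basis; only such operators are used below. -/
def tr (T : H →L[ℂ] H) : ℂ := ∑' i, inner ℂ (basis H i) (T (basis H i))

/-- States (statistical operators): positive operators of trace one. A positive operator is trace
class as soon as the trace series converges in one basis, and a non-convergent
series has `tsum` equal to `0 ≠ 1`. -/
structure State (H : Type*) [NormedAddCommGroup H] [InnerProductSpace ℂ H] [CompleteSpace H] where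
  op : H →L[ℂ] H
  pos : op.IsPositive
  tr_one : tr op = 1

/-- Positive operator valued measures on `X`. Only the values on measurable sets matter. -/
structure POVM (X : Type*) [MeasurableSpace X] (H : Type*) [NormedAddCommGroup H]
    [InnerProductSpace ℂ H] [CompleteSpace H] where
  toFun : Set X → H →L[ℂ] H
  pos : ∀ B, MeasurableSet B → (toFun B).IsPositive
  univ : toFun Set.univ = 1
  hasSum : ∀ f : ℕ → Set X, (∀ i, MeasurableSet (f i)) →
    Pairwise (Function.onFun Disjoint f) → ∀ φ ψ : H,
      HasSum (fun i => inner ℂ φ (toFun (f i) ψ)) (inner ℂ φ (toFun (⋃ i, f i) ψ))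

namespace POVM

variable {X Y : Type*} [MeasurableSpace X] [MeasurableSpace Y]

/-- The image of a POVM under a measurable map; for the two projections of a product these are
the marginals. -/
def map (M : POVM X H) (f : X → Y) (hf : Measurable f) : POVM Y H where
  toFun B := M.toFun (f ⁻¹' B)
  pos B hB := M.pos _ (hf hB)
  univ := by simpa using M.univ
  hasSum s hs hd φ ψ := by
    rw [Set.preimage_iUnion]
    exact M.hasSum _ (fun i => hf (hs i)) (fun i j hij => (hd hij).preimage f) φ ψ

lemma inner_symm_right {H : Type*} [NormedAddCommGroup H] [InnerProductSpace ℂ H] (U : H ≃ₗᵢ[ℂ] H) (x y : H) :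
    inner ℂ x (U.symm y) = inner ℂ (U x) y := by
  rw [← U.inner_map_map, U.apply_symm_apply]

/-- `B ↦ U⁻¹ M(B) U`. -/
def conj (M : POVM X H) (U : H ≃ₗᵢ[ℂ] H) : POVM X H where
  toFun B := (U.symm.toContinuousLinearEquiv : H →L[ℂ] H) ∘L M.toFun B ∘L
    (U.toContinuousLinearEquiv : H →L[ℂ] H)
  pos B hB := by
    have h := M.pos B hB
    refine ⟨fun x y => ?_, fun x => ?_⟩
    · have h1 := h.isSymmetric (U x) (U y)
      have e1 : inner ℂ (U.symm (M.toFun B (U x))) y = inner ℂ (M.toFun B (U x)) (U y) := by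
        rw [← U.inner_map_map, U.apply_symm_apply]
      exact e1.trans (h1.trans (inner_symm_right U x _).symm)
    · have h1 := h.re_inner_nonneg_left (U x)
      have e1 : inner ℂ (U.symm (M.toFun B (U x))) x = inner ℂ (M.toFun B (U x)) (U x) := by
        rw [← U.inner_map_map, U.apply_symm_apply]
      rw [← e1] at h1
      exact h1
  univ := by
    rw [M.univ]
    ext1 x
    exact U.symm_apply_apply x
  hasSum s hs hd φ ψ := by
    have h := M.hasSum s hs hd (U φ) (U ψ)
    simp only [← inner_symm_right] at h
    exact h

open Classical in
/-- The trivial POVM concentrated at a point. -/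
def trivialAt (H : Type*) [NormedAddCommGroup H] [InnerProductSpace ℂ H] [CompleteSpace H]
    (x : X) : POVM X H where
  toFun B := if x ∈ B then 1 else 0
  pos B _ := by
    split_ifs
    · exact ContinuousLinearMap.isPositive_one
    · exact ContinuousLinearMap.isPositive_zero
  univ := by simp
  hasSum s hs hd φ ψ := by
    by_cases h : ∃ i, x ∈ s i
    · obtain ⟨i, hi⟩ := h
      have h1 : x ∈ ⋃ i, s i := Set.mem_iUnion.2 ⟨i, hi⟩
      have h2 : ∀ j, j ≠ i → x ∉ s j := fun j hj hx =>
        Set.disjoint_left.1 (hd hj) hx hi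
      have := hasSum_single (f := fun j => inner ℂ φ
        ((if x ∈ s j then (1 : H →L[ℂ] H) else 0) ψ)) i (fun j hj => by simp [h2 j hj])
      simpa [h1, hi] using this
    · have h1 : x ∉ ⋃ i, s i := by simpa using h
      push Not at h
      simp [h1, h]

lemma empty (M : POVM X H) : M.toFun ∅ = 0 := by
  ext ψ
  have h := M.hasSum (fun _ => ∅) (fun _ => MeasurableSet.empty)
    (fun _ _ _ => by simp [Function.onFun]) (M.toFun ∅ ψ) ψ
  have h0 := (summable_const_iff _).1 h.summable
  simpa using h0

end POVM

namespace State

variable {X : Type*} [MeasurableSpace X]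

lemma summable_diag (ρ : State H) :
    Summable fun i => inner ℂ (basis H i) (ρ.op (basis H i)) := by
  by_contra h
  have := ρ.tr_one
  rw [tr, tsum_eq_zero_of_not_summable h] at this
  exact zero_ne_one this

/-- The positive square root of a state. -/
def sqrtOp (ρ : State H) : H →L[ℂ] H := CFC.sqrt ρ.op

lemma sqrtOp_sq (ρ : State H) (x : H) : ρ.sqrtOp (ρ.sqrtOp x) = ρ.op x := by
  have h := CFC.sqrt_mul_sqrt_self ρ.op ((ContinuousLinearMap.nonneg_iff_isPositive _).2 ρ.pos)
  exact congrArg (fun T : H →L[ℂ] H => T x) h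

lemma sqrtOp_symm (ρ : State H) (x y : H) :
    inner ℂ (ρ.sqrtOp x) y = inner ℂ x (ρ.sqrtOp y) :=
  ((ContinuousLinearMap.nonneg_iff_isPositive _).1 (CFC.sqrt_nonneg ρ.op)).isSymmetric x y

lemma summable_sqrtOp (ρ : State H) : Summable fun i => ‖ρ.sqrtOp (basis H i)‖ ^ 2 := by
  have h := Complex.reCLM.summable ρ.summable_diag
  refine h.congr fun i => ?_
  rw [← ρ.sqrtOp_sq, ← ρ.sqrtOp_symm]
  simp [inner_self_eq_norm_sq_to_K]
  norm_cast

lemma hasSum_norm_sq (x : H) : HasSum (fun i => ‖inner ℂ (basis H i) x‖ ^ 2) (‖x‖ ^ 2) := by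
  have h := Complex.reCLM.hasSum ((basis H).hasSum_inner_mul_inner x x)
  simp only [inner_self_eq_norm_sq_to_K] at h
  convert h using 1
  · funext i
    rw [← inner_conj_symm x, Complex.reCLM_apply, Complex.conj_mul']
    norm_cast
  · simp only [Complex.reCLM_apply]
    norm_cast

lemma summable_sq_double {S : H →L[ℂ] H} (hS : Summable fun i => ‖S (basis H i)‖ ^ 2) :
    Summable fun p : basisIndex H × basisIndex H =>
      ‖inner ℂ (basis H p.2) (S (basis H p.1))‖ ^ 2 := by
  refine (summable_prod_of_nonneg (fun _ => sq_nonneg _)).2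
    ⟨fun i => (hasSum_norm_sq (S (basis H i))).summable, hS.congr fun i => ?_⟩
  exact (hasSum_norm_sq (S (basis H i))).tsum_eq.symm

/-- `Tr{ρ T} = ∑ⱼ ⟪√ρ bⱼ, T √ρ bⱼ⟫`. -/
lemma hasSum_tr_mul (ρ : State H) (T : H →L[ℂ] H) :
    HasSum (fun j => inner ℂ (ρ.sqrtOp (basis H j)) (T (ρ.sqrtOp (basis H j)))) (tr (ρ.op * T)) := by
  set b := basis H
  set S := ρ.sqrtOp
  have hS := ρ.summable_sqrtOp
  let Ta := ContinuousLinearMap.adjoint T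
  have hT : Summable fun i => ‖(Ta ∘L S) (b i)‖ ^ 2 := by
    refine Summable.of_nonneg_of_le (fun _ => sq_nonneg _) (fun i => ?_) (hS.mul_left (‖Ta‖ ^ 2))
    rw [← mul_pow]
    exact pow_le_pow_left₀ (norm_nonneg _) (Ta.le_opNorm _) 2
  let f : basisIndex H → basisIndex H → ℂ := fun i j =>
    inner ℂ (S (b i)) (b j) * inner ℂ (b j) (S (T (b i)))
  have hf : Summable (Function.uncurry f) := by
    have h1 := summable_sq_double hS
    have h2 := (summable_sq_double hT).prod_symm
    refine Summable.of_norm_bounded (h1.add h2) (fun p => ?_)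
    obtain ⟨i, j⟩ := p
    have e1 : ‖inner ℂ (S (b i)) (b j)‖ = ‖inner ℂ (b j) (S (b i))‖ := norm_inner_symm _ _
    have e2 : ‖inner ℂ (b j) (S (T (b i)))‖ = ‖inner ℂ (b i) ((Ta ∘L S) (b j))‖ := by
      rw [← ρ.sqrtOp_symm, ContinuousLinearMap.comp_apply,
        ContinuousLinearMap.adjoint_inner_right, norm_inner_symm]
    change ‖inner ℂ (S (b i)) (b j) * inner ℂ (b j) (S (T (b i)))‖ ≤
      ‖inner ℂ (b j) (S (b i))‖ ^ 2 + ‖inner ℂ (b i) ((Ta ∘L S) (b j))‖ ^ 2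
    rw [norm_mul, e1, e2]
    nlinarith [sq_nonneg (‖inner ℂ (b j) (S (b i))‖ - ‖inner ℂ (b i) ((Ta ∘L S) (b j))‖),
      sq_nonneg (‖inner ℂ (b j) (S (b i))‖), sq_nonneg (‖inner ℂ (b i) ((Ta ∘L S) (b j))‖)]
  have hrow : ∀ i, ∑' j, f i j = inner ℂ (b i) ((ρ.op * T) (b i)) := fun i => by
    rw [(b.hasSum_inner_mul_inner _ _).tsum_eq, ρ.sqrtOp_symm, ρ.sqrtOp_sq]
    rfl
  have hcol : ∀ j, HasSum (fun i => f i j) (inner ℂ (S (b j)) (T (S (b j)))) := fun j => by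
    have h := b.hasSum_inner_mul_inner (Ta (S (b j))) (S (b j))
    rw [ContinuousLinearMap.adjoint_inner_left] at h
    have e0 : (fun i => f i j) =
        fun i => inner ℂ (Ta (S (b j))) (b i) * inner ℂ (b i) (S (b j)) := by
      funext i
      rw [ContinuousLinearMap.adjoint_inner_left, ρ.sqrtOp_symm, ← ρ.sqrtOp_symm (b i), mul_comm]
    rw [e0]
    exact h
  have e : ∑' j, inner ℂ (S (b j)) (T (S (b j))) = tr (ρ.op * T) := by
    rw [tr, ← tsum_congr hrow, ← tsum_congr fun j => (hcol j).tsum_eq]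
    exact hf.tsum_comm
  rw [← e]
  refine Summable.hasSum ?_
  refine hf.prod_symm.prod.congr fun j => ?_
  exact (hcol j).tsum_eq

lemma re_nonneg (ρ : State H) {T : H →L[ℂ] H} (hT : T.IsPositive) (j : basisIndex H) :
    0 ≤ (inner ℂ (ρ.sqrtOp (basis H j)) (T (ρ.sqrtOp (basis H j)))).re :=
  hT.re_inner_nonneg_right _

lemma ofReal_tr (ρ : State H) {T : H →L[ℂ] H} (hT : T.IsPositive) :
    ENNReal.ofReal (tr (ρ.op * T)).re = ∑' j, ENNReal.ofReal
      (inner ℂ (ρ.sqrtOp (basis H j)) (T (ρ.sqrtOp (basis H j)))).re := by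
  have h := Complex.reCLM.hasSum (ρ.hasSum_tr_mul T)
  rw [← ENNReal.ofReal_tsum_of_nonneg (ρ.re_nonneg hT) h.summable]
  exact congrArg ENNReal.ofReal h.tsum_eq.symm

/-- The distribution `M_ρ(B) = Tr{ρ M(B)}` of the observable `M` in the state `ρ`. -/
def outcome (ρ : State H) (M : POVM X H) : Measure X :=
  Measure.ofMeasurable (fun B _ => ENNReal.ofReal (tr (ρ.op * M.toFun B)).re)
    (by simp [M.empty, tr])
    (by
      intro f hf hd
      rw [ρ.ofReal_tr (M.pos _ (MeasurableSet.iUnion hf))]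
      have h1 : ∀ i, ENNReal.ofReal (tr (ρ.op * M.toFun (f i))).re = _ :=
        fun i => ρ.ofReal_tr (M.pos _ (hf i))
      rw [tsum_congr h1, ENNReal.tsum_comm]
      refine tsum_congr fun j => ?_
      have h := Complex.reCLM.hasSum (M.hasSum f hf hd (ρ.sqrtOp (basis H j))
        (ρ.sqrtOp (basis H j)))
      rw [← ENNReal.ofReal_tsum_of_nonneg (fun i => ρ.re_nonneg (M.pos _ (hf i)) j) h.summable]
      exact congrArg ENNReal.ofReal h.tsum_eq.symm)

lemma outcome_apply (ρ : State H) (M : POVM X H) {B : Set X} (hB : MeasurableSet B) :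
    ρ.outcome M B = ENNReal.ofReal (tr (ρ.op * M.toFun B)).re :=
  Measure.ofMeasurable_apply B hB


end State

/-- `T = ∫_Z F dμ` in the weak operator topology. -/
def IsWeakIntegral {X : Type*} [MeasurableSpace X] (F : X → H →L[ℂ] H) (μ : Measure X)
    (Z : Set X) (T : H →L[ℂ] H) : Prop :=
  ∀ φ ψ : H, IntegrableOn (fun x => inner ℂ φ (F x ψ)) Z μ ∧
    inner ℂ φ (T ψ) = ∫ x in Z, inner ℂ φ (F x ψ) ∂μ

end Hilbert

/-- Position (or momentum) space `ℝⁿ`. -/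
abbrev Cfg (n : ℕ) : Type := EuclideanSpace ℝ (Fin n)

/-- The Hilbert space `L²(ℝⁿ)` of the Schrödinger representation. -/
abbrev Hil (n : ℕ) : Type := Lp ℂ 2 (volume : Measure (Cfg n))

section Schrodinger

variable {n : ℕ}

lemma memLp_mul (g : Cfg n → ℂ) (hg : Measurable g) (hb : ∀ y, ‖g y‖ ≤ 1) (ψ : Hil n) :
    MemLp (fun y => g y * ψ y) 2 volume :=
  (Lp.memLp ψ).of_le (hg.aestronglyMeasurable.mul (Lp.aestronglyMeasurable ψ))
    (ae_of_all _ fun y => by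
      rw [norm_mul]
      exact mul_le_of_le_one_left (norm_nonneg _) (hb y))

/-- Multiplication by a measurable function bounded by one. -/
def mulOp (g : Cfg n → ℂ) (hg : Measurable g) (hb : ∀ y, ‖g y‖ ≤ 1) : Hil n →L[ℂ] Hil n :=
  LinearMap.mkContinuous
    { toFun := fun ψ => (memLp_mul g hg hb ψ).toLp _
      map_add' := fun φ ψ => by
        rw [← MemLp.toLp_add]
        refine MemLp.toLp_congr _ _ ?_
        filter_upwards [Lp.coeFn_add φ ψ] with y hy
        change g y * (φ + ψ : Hil n) y = g y * φ y + g y * ψ y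
        rw [hy, Pi.add_apply, mul_add]
      map_smul' := fun c ψ => by
        rw [RingHom.id_apply, ← MemLp.toLp_const_smul]
        refine MemLp.toLp_congr _ _ ?_
        filter_upwards [Lp.coeFn_smul c ψ] with y hy
        change g y * (c • ψ : Hil n) y = c * (g y * ψ y)
        rw [hy, Pi.smul_apply, smul_eq_mul, mul_left_comm] }
    1 (fun ψ => by
        rw [one_mul]
        refine Lp.norm_le_norm_of_ae_le ?_
        filter_upwards [(memLp_mul g hg hb ψ).coeFn_toLp] with y hy
        change ‖((memLp_mul g hg hb ψ).toLp _ : Cfg n → ℂ) y‖ ≤ _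
        rw [hy, norm_mul]
        exact mul_le_of_le_one_left (norm_nonneg _) (hb y))

lemma mulOp_coe (g : Cfg n → ℂ) (hg : Measurable g) (hb : ∀ y, ‖g y‖ ≤ 1) (ψ : Hil n) :
    mulOp g hg hb ψ =ᵐ[volume] fun y => g y * ψ y := by
  exact (memLp_mul g hg hb ψ).coeFn_toLp

/-- The translation `ψ ↦ ψ(· - x)`. -/
def transl (x : Cfg n) : Hil n →L[ℂ] Hil n :=
  (Lp.compMeasurePreservingₗᵢ ℂ (fun y : Cfg n => y - x)
    (measurePreserving_sub_right volume x)).toContinuousLinearMap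

/-- The parity operator `(Πψ)(y) = ψ(-y)`. -/
def parity : Hil n →L[ℂ] Hil n :=
  (Lp.compMeasurePreservingₗᵢ ℂ (fun y : Cfg n => -y)
    (Measure.measurePreserving_neg volume)).toContinuousLinearMap

/-- The Weyl operators `W(x,p) = exp{(i/ħ)(p·Q - x·P)}
= exp{(i/ħ) p·Q} exp{-(i/ħ) x·P} exp{-(i/2ħ) x·p}`, that is
`(W(x,p)ψ)(y) = exp{(i/ħ)(p·y - x·p/2)} ψ(y - x)`. -/
def weyl (ħ : ℝ) (x p : Cfg n) : Hil n →L[ℂ] Hil n :=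
  mulOp (fun y => Complex.exp (((⟪p, y⟫ - ⟪x, p⟫ / 2) / ħ : ℝ) * Complex.I))
    (by fun_prop) (fun y => (Complex.norm_exp_ofReal_mul_I _).le) ∘L transl x

/-- The characteristic function `ρ̂(k,l) = Tr{ρ W(-ħl, ħk)} = Tr{ρ exp{i(k·Q + l·P)}}`. -/
def charFn (ħ : ℝ) (ρ : State (Hil n)) (k l : Cfg n) : ℂ :=
  tr (ρ.op * weyl ħ (-(ħ • l)) (ħ • k))

lemma inner_mulOp_indicator {B : Set (Cfg n)} (hB : MeasurableSet B)
    (hg : Measurable (B.indicator (1 : Cfg n → ℂ)))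
    (hb : ∀ y, ‖B.indicator (1 : Cfg n → ℂ) y‖ ≤ 1) (φ ψ : Hil n) :
    inner ℂ φ (mulOp _ hg hb ψ) = ∫ y in B, inner ℂ (φ y) (ψ y) := by
  rw [L2.inner_def, ← integral_indicator hB]
  refine integral_congr_ae ?_
  filter_upwards [mulOp_coe _ hg hb ψ] with y hy
  rw [hy]
  by_cases h : y ∈ B <;> simp [h]

open Classical in
/-- The projection valued measure of the position vector `Q`: `Q(B)` is multiplication by the
indicator function of `B`. -/
def posObs (n : ℕ) : POVM (Cfg n) (Hil n) where
  toFun B := if hB : MeasurableSet B then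
    mulOp (B.indicator 1) (measurable_one.indicator hB)
      (fun y => by by_cases h : y ∈ B <;> simp [h]) else 0
  pos B hB := by
    rw [dif_pos hB]
    refine (ContinuousLinearMap.isPositive_def').2 ⟨?_, fun ψ => ?_⟩
    · rw [ContinuousLinearMap.isSelfAdjoint_iff_isSymmetric]
      intro φ ψ
      change inner ℂ (mulOp _ _ _ φ) ψ = inner ℂ φ (mulOp _ _ _ ψ)
      rw [← inner_conj_symm, inner_mulOp_indicator hB, inner_mulOp_indicator hB, ← integral_conj]
      simp only [inner_conj_symm]
    · rw [ContinuousLinearMap.reApplyInnerSelf_apply, inner_re_symm, inner_mulOp_indicator hB]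
      have h : ∀ y, inner ℂ (ψ y) (ψ y) = ((‖ψ y‖ ^ 2 : ℝ) : ℂ) := fun y => by
        rw [inner_self_eq_norm_sq_to_K]
        norm_cast
      simp only [h]
      rw [integral_complex_ofReal]
      exact integral_nonneg fun y => sq_nonneg _
  univ := by
    rw [dif_pos MeasurableSet.univ]
    refine ContinuousLinearMap.ext fun ψ => Lp.ext ?_
    filter_upwards [mulOp_coe _ (measurable_one.indicator MeasurableSet.univ)
      (fun y => by simp) ψ] with y hy
    rw [hy]
    simp
  hasSum s hs hd φ ψ := by
    have hU := MeasurableSet.iUnion hs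
    simp only [dif_pos hU, dif_pos (hs _), inner_mulOp_indicator hU, inner_mulOp_indicator (hs _)]
    exact hasSum_integral_iUnion hs hd (L2.integrable_inner φ ψ).integrableOn

/-- The projection valued measure of the momentum vector `P = -iħ∇`: in the Fourier representation
`(𝓕ψ)(ξ) = ∫ e^{-2πi ξ·y} ψ(y) dy` the momentum is multiplication by `p = 2πħξ`. -/
def momObs (ħ : ℝ) (n : ℕ) : POVM (Cfg n) (Hil n) :=
  ((posObs n).map (fun ξ : Cfg n => (2 * Real.pi * ħ) • ξ) (by fun_prop)).conj
    (Lp.fourierTransformₗᵢ (Cfg n) ℂ)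

/-- The operator density `M^σ(x,p) = (2πħ)⁻ⁿ W(x,p) Π σ Π W(x,p)*`. -/
def covDensity (ħ : ℝ) (σ : State (Hil n)) (z : Cfg n × Cfg n) : Hil n →L[ℂ] Hil n :=
  (((2 * Real.pi * ħ) ^ n)⁻¹ : ℂ) • (weyl ħ z.1 z.2 * parity * σ.op * parity *
    ContinuousLinearMap.adjoint (weyl ħ z.1 z.2))

open Classical in
/-- The covariant phase-space observable `M^σ`: the POVM on `ℝⁿ × ℝⁿ` given by the weak integrals
`M^σ(Z) = ∫_Z M^σ(x,p) dx dp`, which determine its values on all measurable sets.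
(The last line is never reached when `ħ > 0`.) -/
def covObs (ħ : ℝ) (σ : State (Hil n)) : POVM (Cfg n × Cfg n) (Hil n) :=
  if h : ∃ M : POVM (Cfg n × Cfg n) (Hil n), ∀ Z, MeasurableSet Z →
      IsWeakIntegral (covDensity ħ σ) volume Z (M.toFun Z)
  then h.choose else POVM.trivialAt (Hil n) 0

open scoped ComplexOrder in
/-- Gaussian states: `ρ̂(k,l) = exp{i(k·a + l·b) - (k·Ak + l·Bl)/2 - k·Cl}` for some vectors `a`, `b`
and some real matrix `V = (A, C; Cᵀ, B)` such that `V + (i/2)Ω ≥ 0`, with `Ω = (0, ħ1; -ħ1, 0)`. -/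
def IsGaussian (ħ : ℝ) (ρ : State (Hil n)) : Prop :=
  ∃ (a b : Fin n → ℝ) (A B C : Matrix (Fin n) (Fin n) ℝ),
    (Matrix.fromBlocks (A.map Complex.ofReal)
      (C.map Complex.ofReal + (Complex.I * (ħ / 2)) • (1 : Matrix (Fin n) (Fin n) ℂ))
      (C.transpose.map Complex.ofReal - (Complex.I * (ħ / 2)) • (1 : Matrix (Fin n) (Fin n) ℂ))
      (B.map Complex.ofReal)).PosSemidef ∧
    ∀ k l : Cfg n, charFn ħ ρ k l = Complex.exp (
      Complex.I * ((k ⬝ᵥ a + l ⬝ᵥ b : ℝ) : ℂ)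
      - ((k ⬝ᵥ A.mulVec k + l ⬝ᵥ B.mulVec l : ℝ) : ℂ) / 2
      - ((k ⬝ᵥ C.mulVec l : ℝ) : ℂ))

end Schrodinger

section Entropy

variable {n : ℕ}

/-- Mean vector of a distribution on `ℝⁿ`. -/
def meanVec (μ : Measure (Cfg n)) : Fin n → ℝ := fun i => ∫ x, x i ∂μ

/-- Variance matrix of a distribution on `ℝⁿ`. -/
def varMat (μ : Measure (Cfg n)) : Matrix (Fin n) (Fin n) ℝ :=
  Matrix.of fun i j => ∫ x, (x i - meanVec μ i) * (x j - meanVec μ j) ∂μ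

/-- Relative entropy `S(p‖q) ∈ [0, ∞]` with logarithms to base 2; `klDiv` uses the natural one. -/
def relEntropy (p q : Measure (Cfg n)) : ℝ≥0∞ :=
  ENNReal.ofReal (Real.logb 2 (Real.exp 1)) * InformationTheory.klDiv p q

/-- The error function `S(ρ, M) = S(Q_ρ ‖ M_{1,ρ}) + S(P_ρ ‖ M_{2,ρ})`. -/
def errorFunction (ħ : ℝ) (ρ : State (Hil n)) (M : POVM (Cfg n × Cfg n) (Hil n)) : ℝ≥0∞ :=
  relEntropy (ρ.outcome (posObs n)) (ρ.outcome (M.map Prod.fst measurable_fst)) +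
    relEntropy (ρ.outcome (momObs ħ n)) (ρ.outcome (M.map Prod.snd measurable_snd))

/-- `a^ρ` -/
def posMean (ρ : State (Hil n)) : Fin n → ℝ := meanVec (ρ.outcome (posObs n))

/-- `A^ρ` -/
def posVar (ρ : State (Hil n)) : Matrix (Fin n) (Fin n) ℝ := varMat (ρ.outcome (posObs n))

/-- `b^ρ` -/
def momMean (ħ : ℝ) (ρ : State (Hil n)) : Fin n → ℝ := meanVec (ρ.outcome (momObs ħ n))

/-- `B^ρ` -/
def momVar (ħ : ℝ) (ρ : State (Hil n)) : Matrix (Fin n) (Fin n) ℝ :=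
  varMat (ρ.outcome (momObs ħ n))

/-- `s(x) = ln(1+x) - x/(1+x)` -/
def sFun (x : ℝ) : ℝ := Real.log (1 + x) - x / (1 + x)

/-- The power `A^{-1/2}` of a positive definite real matrix, by functional calculus. -/
def invSqrt (A : Matrix (Fin n) (Fin n) ℝ) : Matrix (Fin n) (Fin n) ℝ :=
  cfc (fun x : ℝ => x ^ (-(1 / 2) : ℝ)) A

/-- `A^{-1/2} B A^{-1/2}` -/
def congruence (A B : Matrix (Fin n) (Fin n) ℝ) : Matrix (Fin n) (Fin n) ℝ :=
  invSqrt A * B * invSqrt A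

end Entropy

end QMeas

end

/-! The measurement adds independent noise to each outcome distribution: the marginals of $\mathsf
M^\sigma$ in the state $\rho$ are the convolutions $\mathsf Q_\rho*\mathsf Q_\sigma$ and $\mathsf
P_\rho*\mathsf P_\sigma$ (`State.outcome_covObs_fst_eq_conv`, `State.outcome_covObs_snd_eq_conv`).
To see this, expand both states into rank one pieces $|\sqrt\rho\,b_j\rangle\langle\sqrt\rho\,b_j|$.
The amplitude of such a pair is, up to a phase, a Fourier integral of $\overline{u(y)}\,v(q-y)$, and
Plancherel in the conjugate variable leaves $|u|^2*|v|^2$. The parity operator in $\mathsf M^\sigma$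
is what produces $v(q-y)$, hence a convolution with no reflection. The $L^2$ Fourier transform
exchanges translations and modulations, so the momentum marginal follows from the same computation.
The total mass found in this way also shows that the operator density integrates to the identity, so
that the observable exists (`exists_povm_isWeakIntegral`).

For Gaussian states, restricting the characteristic function to $l=0$ or $k=0$ identifies $\mathsf
Q$ and $\mathsf P$ as normal distributions. The uncertainty inequality with $\hbar>0$ makes their
variances positive definite (`posDef_of_uncertainty`), so they have densities. Each term of the
error function is then the divergence of $N(a,A)$ from $N(a+a',A+A')$, which
`klDiv_multivariateGaussian` evaluates as $\frac12[\ln\frac{\det(A+A')}{\det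
A}-n+\mathrm{Tr}\,(A+A')^{-1}A+a'\cdot(A+A')^{-1}a']$.

Since $s(x)=\ln(1+x)-1+\frac1{1+x}$ and $1+E=A^{-1/2}(A+A')A^{-1/2}$, the first three terms are
$\mathrm{Tr}\,s(E)$. The matrix $N^{-1}$ gives the same number, whence the second expression. -/

namespace Matrix

/-! ### Traces of functional calculus on positive definite matrices -/

variable {n : ℕ} {A B X : Matrix (Fin n) (Fin n) ℝ}

lemma IsHermitian.trace_cfc (hX : X.IsHermitian) (f : ℝ → ℝ) :
    (cfc f X).trace = ∑ i, f (hX.eigenvalues i) := by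
  rw [hX.cfc_eq, IsHermitian.cfc, Unitary.conjStarAlgAut_apply, trace_mul_cycle,
    Unitary.coe_star_mul_self, one_mul, trace_diagonal]
  rfl

lemma IsHermitian.det_cfc (hX : X.IsHermitian) (f : ℝ → ℝ) :
    (cfc f X).det = ∏ i, f (hX.eigenvalues i) := by
  rw [hX.cfc_eq, IsHermitian.cfc, Unitary.conjStarAlgAut_apply, det_mul_comm, ← mul_assoc,
    Unitary.coe_star_mul_self, one_mul, det_diagonal]
  rfl

lemma continuousOn_spectrum_real (X : Matrix (Fin n) (Fin n) ℝ) (f : ℝ → ℝ) :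
    ContinuousOn f (spectrum ℝ X) :=
  X.finite_real_spectrum.continuousOn f

lemma PosDef.spectrum_pos (hX : X.PosDef) {x : ℝ} (hx : x ∈ spectrum ℝ X) : 0 < x := by
  rw [hX.1.spectrum_real_eq_range_eigenvalues] at hx
  obtain ⟨i, rfl⟩ := hx
  exact hX.eigenvalues_pos i

/-- On each eigenvalue $s(x)=\ln(1+x)-1+\frac1{1+x}$. The resulting form contains only a determinant
and the trace of an inverse, both accessible to plain matrix algebra. -/
lemma PosDef.trace_cfc_sFun (hX : X.PosDef) :
    (cfc QMeas.sFun X).trace = Real.log (1 + X).det - n + ((1 + X)⁻¹).trace := by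
  have hc := continuousOn_spectrum_real X
  have hs : IsSelfAdjoint X := hX.1
  have e1 : cfc (fun x : ℝ => 1 + x) X = 1 + X := by
    rw [cfc_const_add (R := ℝ) 1 (fun x => x) X (hc _) hs, cfc_id' ℝ X hs, map_one]
  have e2 : (1 + X)⁻¹ = cfc (fun x : ℝ => (1 + x)⁻¹) X := by
    refine inv_eq_left_inv ?_
    rw [← e1, ← cfc_mul _ _ X (hc _) (hc _)]
    rw [← cfc_one ℝ X hs]
    refine cfc_congr fun x hx => ?_
    have := hX.spectrum_pos hx
    simp only [Pi.one_apply]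
    field_simp
  rw [e2, ← e1, hX.1.trace_cfc, hX.1.trace_cfc, hX.1.det_cfc, Real.log_prod fun i _ => by
    have := hX.eigenvalues_pos i; positivity]
  have : (n : ℝ) = ∑ i : Fin n, 1 := by simp
  rw [this, ← Finset.sum_sub_distrib, ← Finset.sum_add_distrib]
  refine Finset.sum_congr rfl fun i _ => ?_
  have := hX.eigenvalues_pos i
  rw [QMeas.sFun]
  field_simp
  ring

section InvSqrt

open QMeas

lemma isHermitian_invSqrt (A : Matrix (Fin n) (Fin n) ℝ) : (invSqrt A).IsHermitian :=
  cfc_predicate _ A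

lemma PosDef.invSqrt_mul_self_mul (hA : A.PosDef) : invSqrt A * invSqrt A * A = 1 := by
  have hc := continuousOn_spectrum_real A
  have hs : IsSelfAdjoint A := hA.1
  have e : invSqrt A * invSqrt A * A =
      invSqrt A * invSqrt A * cfc (fun x : ℝ => x) A := by rw [cfc_id' ℝ A hs]
  rw [e, invSqrt, ← cfc_mul _ _ A (hc _) (hc _), ← cfc_mul _ _ A (hc _) (hc _),
    ← cfc_one ℝ A hs]
  refine cfc_congr fun x hx => ?_
  have hx := hA.spectrum_pos hx
  simp only [Pi.one_apply]
  rw [← Real.rpow_add hx]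
  norm_num
  rw [Real.rpow_neg_one, inv_mul_cancel₀ hx.ne']

lemma PosDef.invSqrt_mul_invSqrt (hA : A.PosDef) : invSqrt A * invSqrt A = A⁻¹ :=
  (inv_eq_left_inv hA.invSqrt_mul_self_mul).symm

lemma PosDef.isUnit_det_invSqrt (hA : A.PosDef) : IsUnit (invSqrt A).det := by
  have h := congrArg det hA.invSqrt_mul_self_mul
  rw [det_mul, det_mul, det_one, mul_assoc] at h
  exact .of_mul_eq_one _ h

lemma PosDef.invSqrt_mul_mul_invSqrt (hA : A.PosDef) : invSqrt A * A * invSqrt A = 1 := by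
  have h : invSqrt A * (invSqrt A * A) = 1 := by rw [← mul_assoc, hA.invSqrt_mul_self_mul]
  exact mul_eq_one_comm.1 h

lemma PosDef.congruence (hA : A.PosDef) (hB : B.PosDef) : (congruence A B).PosDef := by
  have h := hB.conjTranspose_mul_mul_same (B := invSqrt A)
    (mulVec_injective_of_isUnit ((isUnit_iff_isUnit_det _).2 hA.isUnit_det_invSqrt))
  rwa [(isHermitian_invSqrt A).eq] at h

/-- Here $1+E=A^{-1/2}(A+B)A^{-1/2}$. In the determinant and, by cyclicity, in the trace of the
inverse, the two roots meet and combine to $A^{-1}$ or $A$, so no square root survives. -/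
lemma PosDef.trace_sFun_congruence (hA : A.PosDef) (hB : B.PosDef) :
    (cfc sFun (QMeas.congruence A B)).trace =
      Real.log ((A + B).det / A.det) - n + ((A + B)⁻¹ * A).trace := by
  have e : 1 + QMeas.congruence A B = invSqrt A * (A + B) * invSqrt A := by
    rw [mul_add, add_mul, hA.invSqrt_mul_mul_invSqrt, QMeas.congruence]
  have hu := hA.isUnit_det_invSqrt
  rw [(hA.congruence hB).trace_cfc_sFun, e]
  congr 1
  · congr 2
    rw [det_mul, det_mul, mul_right_comm, ← det_mul, hA.invSqrt_mul_invSqrt, det_nonsing_inv,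
      Ring.inverse_eq_inv', mul_comm, div_eq_mul_inv]
  · have hS : (invSqrt A)⁻¹ * (invSqrt A)⁻¹ = A := by
      rw [← mul_inv_rev, hA.invSqrt_mul_invSqrt, nonsing_inv_nonsing_inv _ hA.det_pos.ne'.isUnit]
    rw [mul_inv_rev, mul_inv_rev, trace_mul_comm, mul_assoc, hS]

/-- The right side agrees with that of `PosDef.trace_sFun_congruence`; this is the equivalence of
the two expressions. It comes from $1+N^{-1}=B^{1/2}\,B^{-1}(A+B)A^{-1}\,B^{1/2}$, where $B^{1/2}$
appears as the inverse of `invSqrt B`. -/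
lemma PosDef.trace_sFun_congruence_inv (hA : A.PosDef) (hB : B.PosDef) :
    (cfc sFun (QMeas.congruence B A)⁻¹).trace =
      Real.log ((A + B).det / A.det) - n + ((A + B)⁻¹ * A).trace := by
  have hu := hB.isUnit_det_invSqrt
  have huA := hA.det_pos.ne'.isUnit
  have huB := hB.det_pos.ne'.isUnit
  have hS : (invSqrt B)⁻¹ * (invSqrt B)⁻¹ = B := by
    rw [← mul_inv_rev, hB.invSqrt_mul_invSqrt, nonsing_inv_nonsing_inv _ huB]
  have h1 : (invSqrt B)⁻¹ * B⁻¹ * (invSqrt B)⁻¹ = 1 := by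
    rw [← mul_inv_rev, ← mul_inv_rev, ← mul_assoc, hB.invSqrt_mul_mul_invSqrt, inv_one]
  have e0 : B⁻¹ + A⁻¹ = B⁻¹ * (A + B) * A⁻¹ := by
    rw [mul_add, add_mul, mul_assoc, mul_nonsing_inv _ huA, nonsing_inv_mul _ huB, mul_one,
      one_mul]
  have e : 1 + (QMeas.congruence B A)⁻¹ =
      (invSqrt B)⁻¹ * (B⁻¹ * (A + B) * A⁻¹) * (invSqrt B)⁻¹ := by
    rw [← e0, mul_add, add_mul, h1, QMeas.congruence, mul_inv_rev, mul_inv_rev, mul_assoc]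
  rw [(hB.congruence hA).inv.trace_cfc_sFun, e]
  congr 1
  · congr 2
    have h2 : (invSqrt B)⁻¹.det * (invSqrt B)⁻¹.det = B.det := by rw [← det_mul, hS]
    rw [det_mul, det_mul, det_mul, det_mul, mul_right_comm, h2, det_nonsing_inv, det_nonsing_inv,
      Ring.inverse_eq_inv', div_eq_mul_inv, ← mul_assoc, ← mul_assoc,
      mul_inv_cancel₀ hB.det_pos.ne', one_mul]
  · rw [mul_inv_rev, nonsing_inv_nonsing_inv _ hu, mul_inv_rev, mul_inv_rev, mul_inv_rev,
      nonsing_inv_nonsing_inv _ huA, nonsing_inv_nonsing_inv _ huB,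
      nonsing_inv_nonsing_inv _ hu, trace_mul_comm, mul_assoc, hB.invSqrt_mul_invSqrt,
      ← mul_assoc, mul_assoc, mul_nonsing_inv _ huB, mul_one, trace_mul_comm]

end InvSqrt

end Matrix

/-! ### Densities, moments and relative entropy of Gaussian measures -/

namespace QMeas

open Matrix ProbabilityTheory
open scoped MatrixOrder

variable {n : ℕ}

lemma integral_gaussian_charFun (t : Cfg n) :
    ∫ x : Cfg n, Complex.exp (⟪x, t⟫ * Complex.I) *
      ((Real.exp (-‖x‖ ^ 2 / 2) : ℝ) : ℂ) =
      ((Real.sqrt ((2 * Real.pi) ^ n) : ℝ) : ℂ) * Complex.exp (-‖t‖ ^ 2 / 2) := by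
  have h := GaussianFourier.integral_cexp_neg_mul_sq_norm_add (V := Cfg n) (b := 1 / 2)
    (by norm_num) Complex.I t
  have e : ∀ x : Cfg n, Complex.exp (⟪x, t⟫ * Complex.I) * ((Real.exp (-‖x‖ ^ 2 / 2) : ℝ) : ℂ) =
      Complex.exp (-(1 / 2) * ‖x‖ ^ 2 + Complex.I * ⟪t, x⟫) := fun x => by
    rw [Complex.ofReal_exp, ← Complex.exp_add, real_inner_comm]
    congr 1
    push_cast
    ring
  simp only [e]
  rw [h]
  congr 1
  · rw [finrank_euclideanSpace_fin, Real.sqrt_eq_rpow, ← Real.rpow_natCast, ← Real.rpow_mul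
      (by positivity), Complex.ofReal_cpow (by positivity)]
    push_cast
    congr 1 <;> ring
  · congr 1
    rw [Complex.I_sq]
    ring

lemma integral_exp_neg_sq_half :
    ∫ x : Cfg n, Real.exp (-‖x‖ ^ 2 / 2) = Real.sqrt ((2 * Real.pi) ^ n) := by
  have h := integral_gaussian_charFun (0 : Cfg n)
  simp only [inner_zero_right, Complex.ofReal_zero, zero_mul, Complex.exp_zero, one_mul, norm_zero,
    ne_eq, OfNat.ofNat_ne_zero, not_false_eq_true, zero_pow, neg_zero, zero_div, mul_one] at h
  rw [integral_complex_ofReal] at h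
  exact_mod_cast h

lemma integrable_exp_neg_sq_half : Integrable fun x : Cfg n => Real.exp (-‖x‖ ^ 2 / 2) := by
  -- The integral of a nonintegrable function is 0 by convention, whereas the value already computed
  -- is positive.
  by_contra h
  have h1 := integral_exp_neg_sq_half (n := n)
  rw [integral_undef h] at h1
  have : 0 < Real.sqrt ((2 * Real.pi) ^ n) := by positivity
  exact this.ne h1

/-- Two finite measures with the same characteristic function coincide. -/
lemma stdGaussian_eq_withDensity : stdGaussian (Cfg n) = volume.withDensity (fun x =>
    ENNReal.ofReal ((Real.sqrt ((2 * Real.pi) ^ n))⁻¹ * Real.exp (-‖x‖ ^ 2 / 2))) := by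
  have hpos : 0 < Real.sqrt ((2 * Real.pi) ^ n) := by positivity
  have hi : Integrable fun x : Cfg n =>
      (Real.sqrt ((2 * Real.pi) ^ n))⁻¹ * Real.exp (-‖x‖ ^ 2 / 2) :=
    integrable_exp_neg_sq_half.const_mul _
  have : IsFiniteMeasure (volume.withDensity (fun x : Cfg n =>
      ENNReal.ofReal ((Real.sqrt ((2 * Real.pi) ^ n))⁻¹ * Real.exp (-‖x‖ ^ 2 / 2)))) :=
    isFiniteMeasure_withDensity_ofReal hi.2
  refine Measure.ext_of_charFun ?_
  funext t
  rw [charFun_stdGaussian, charFun_apply, integral_withDensity_eq_integral_toReal_smul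
    (by fun_prop) (ae_of_all _ fun _ => ENNReal.ofReal_lt_top)]
  have e : ∀ x : Cfg n, (ENNReal.ofReal ((Real.sqrt ((2 * Real.pi) ^ n))⁻¹ *
      Real.exp (-‖x‖ ^ 2 / 2))).toReal • Complex.exp (⟪x, t⟫ * Complex.I) =
      ((Real.sqrt ((2 * Real.pi) ^ n) : ℝ) : ℂ)⁻¹ * (Complex.exp (⟪x, t⟫ * Complex.I) *
      ((Real.exp (-‖x‖ ^ 2 / 2) : ℝ) : ℂ)) := fun x => by
    rw [ENNReal.toReal_ofReal (by positivity), Complex.real_smul]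
    push_cast
    ring
  simp only [e]
  rw [integral_const_mul, integral_gaussian_charFun, inv_mul_cancel_left₀]
  exact_mod_cast hpos.ne'

/-- The logarithm of the density of the Gaussian measure with mean `m` and variance `S`, up to the
constant `-(n / 2) log (2 π)`. -/
noncomputable def logGauss (m : Cfg n) (S : Matrix (Fin n) (Fin n) ℝ) (x : Cfg n) : ℝ :=
  -(Real.log S.det + (x.ofLp - m.ofLp) ⬝ᵥ S⁻¹ *ᵥ (x.ofLp - m.ofLp)) / 2

lemma _root_.Matrix.PosDef.exists_sqrt {S : Matrix (Fin n) (Fin n) ℝ} (hS : S.PosDef) :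
    CFC.sqrt S * CFC.sqrt S = S ∧ 0 < (CFC.sqrt S).det ∧ (CFC.sqrt S)ᵀ = CFC.sqrt S := by
  have h1 : CFC.sqrt S * CFC.sqrt S = S := CFC.sqrt_mul_sqrt_self S hS.posSemidef.nonneg
  have h2 : (CFC.sqrt S).PosSemidef := nonneg_iff_posSemidef.1 (CFC.sqrt_nonneg S)
  refine ⟨h1, h2.det_nonneg.lt_of_ne fun h0 => ?_, ?_⟩
  · have h := hS.det_pos
    rw [← h1, det_mul, ← h0, mul_zero] at h
    exact h.false
  · exact h2.1.eq

lemma det_toEuclideanCLM (R : Matrix (Fin n) (Fin n) ℝ) :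
    (toEuclideanCLM (𝕜 := ℝ) R : Cfg n →L[ℝ] Cfg n).det = R.det := by
  rw [ContinuousLinearMap.det]
  change LinearMap.det (Matrix.toLpLin 2 2 R) = _
  rw [Matrix.toLpLin_eq_toLin, LinearMap.det_toLin]

/-- This is the integrand after the substitution $x\mapsto m+\sqrt S\,x$: the Jacobian cancels the
factor $(\det S)^{-1/2}$ contained in `logGauss`, and the quadratic form becomes $\|x\|^2$. -/
lemma exp_logGauss_sqrt (m : Cfg n) {S : Matrix (Fin n) (Fin n) ℝ} (hS : S.PosDef) (x : Cfg n) :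
    |(CFC.sqrt S).det| * Real.exp (logGauss m S (m + toEuclideanCLM (𝕜 := ℝ) (CFC.sqrt S) x)) =
      Real.exp (-‖x‖ ^ 2 / 2) := by
  obtain ⟨h1, h2, h3⟩ := hS.exists_sqrt
  set R := CFC.sqrt S
  have hR : R * S⁻¹ * R = 1 := by
    have hu : IsUnit R.det := h2.ne'.isUnit
    rw [← h1, Matrix.mul_inv_rev, ← mul_assoc, mul_nonsing_inv _ hu, one_mul, nonsing_inv_mul _ hu]
  have hq : ((m + toEuclideanCLM (𝕜 := ℝ) R x).ofLp - m.ofLp) ⬝ᵥ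
      S⁻¹ *ᵥ ((m + toEuclideanCLM (𝕜 := ℝ) R x).ofLp - m.ofLp) = ‖x‖ ^ 2 := by
    rw [WithLp.ofLp_add, add_sub_cancel_left, ofLp_toEuclideanCLM, dotProduct_mulVec,
      dotProduct_mulVec, vecMul_vecMul, ← vecMul_transpose, vecMul_vecMul, h3, ← mul_assoc, hR,
      vecMul_one, EuclideanSpace.real_norm_sq_eq]
    simp [dotProduct, sq]
  rw [logGauss, hq, ← h1, det_mul, abs_of_pos h2]
  rw [Real.log_mul h2.ne' h2.ne', show -(Real.log R.det + Real.log R.det + ‖x‖ ^ 2) / 2 =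
    -Real.log R.det + -‖x‖ ^ 2 / 2 by ring, Real.exp_add, Real.exp_neg, Real.exp_log h2,
    mul_inv_cancel_left₀ h2.ne']

lemma multivariateGaussian_eq_withDensity (m : Cfg n) {S : Matrix (Fin n) (Fin n) ℝ}
    (hS : S.PosDef) : multivariateGaussian m S = volume.withDensity (fun x =>
      ENNReal.ofReal ((Real.sqrt ((2 * Real.pi) ^ n))⁻¹ * Real.exp (logGauss m S x))) := by
  obtain ⟨h1, h2, h3⟩ := hS.exists_sqrt
  ext B hB
  set T : Cfg n → Cfg n := fun x => m + toEuclideanCLM (𝕜 := ℝ) (CFC.sqrt S) x with hT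
  have hTm : Measurable T := by fun_prop
  have hinv : ∀ x : Cfg n, toEuclideanCLM (𝕜 := ℝ) (CFC.sqrt S)
      (toEuclideanCLM (𝕜 := ℝ) (CFC.sqrt S)⁻¹ x) = x := fun x => by
    rw [← mul_apply_eq_comp, ← map_mul, mul_nonsing_inv _ h2.ne'.isUnit, map_one]
    rfl
  have hinv' : ∀ x : Cfg n, toEuclideanCLM (𝕜 := ℝ) (CFC.sqrt S)⁻¹
      (toEuclideanCLM (𝕜 := ℝ) (CFC.sqrt S) x) = x := fun x => by
    rw [← mul_apply_eq_comp, ← map_mul, nonsing_inv_mul _ h2.ne'.isUnit, map_one]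
    rfl
  have hinj : Function.Injective T := fun x y hxy => by
    have := add_left_cancel hxy
    rw [← hinv' x, this, hinv']
  have hsurj : Function.Surjective T := fun y =>
    ⟨toEuclideanCLM (𝕜 := ℝ) (CFC.sqrt S)⁻¹ (y - m), by simp only [hT, hinv]; abel⟩
  rw [multivariateGaussian, Measure.map_apply hTm hB, stdGaussian_eq_withDensity,
    withDensity_apply _ (hTm hB), withDensity_apply _ hB]
  -- The domain of integration must be an image under `T` for the change of variables formula.
  conv_rhs => rw [← Set.image_preimage_eq B hsurj]
  rw [lintegral_image_eq_lintegral_abs_det_fderiv_mul volume (hTm hB)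
    (f' := fun _ => toEuclideanCLM (𝕜 := ℝ) (CFC.sqrt S))
    (fun x _ => ((ContinuousLinearMap.hasFDerivAt _).const_add m).hasFDerivWithinAt)
    hinj.injOn]
  refine lintegral_congr fun x => ?_
  rw [← ENNReal.ofReal_mul (abs_nonneg _), det_toEuclideanCLM, mul_left_comm,
    exp_logGauss_sqrt m hS]

lemma memLp_coord (m c : Cfg n) (S : Matrix (Fin n) (Fin n) ℝ) (i : Fin n) :
    MemLp (fun x : Cfg n => x i - c i) 2 (multivariateGaussian m S) := by
  have h : MemLp (fun x : Cfg n => x i) 2 (multivariateGaussian m S) :=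
    (EuclideanSpace.proj (𝕜 := ℝ) i).comp_memLp' IsGaussian.memLp_two_id
  exact h.sub (memLp_const _)

lemma integral_coord (m : Cfg n) (S : Matrix (Fin n) (Fin n) ℝ) (i : Fin n) :
    ∫ x, x i ∂(multivariateGaussian m S) = m i := by
  have h := (EuclideanSpace.proj (𝕜 := ℝ) i).integral_comp_comm
    (IsGaussian.integrable_fun_id (μ := multivariateGaussian m S))
  rw [integral_id_multivariateGaussian] at h
  exact h

lemma integral_coord_mul_coord (m c : Cfg n) {S : Matrix (Fin n) (Fin n) ℝ} (hS : S.PosSemidef)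
    (i j : Fin n) : ∫ x, (x i - c i) * (x j - c j) ∂(multivariateGaussian m S) =
      S i j + (m i - c i) * (m j - c j) := by
  have h : ∀ i, Integrable (fun x : Cfg n => x i) (multivariateGaussian m S) := fun i => by
    simpa using (memLp_coord m 0 S i).integrable one_le_two
  have h1 : ∀ i, ∫ x, (x i - c i) ∂(multivariateGaussian m S) = m i - c i := fun i => by
    rw [integral_sub (h i) (integrable_const _), integral_coord]
    simp
  have h2 := covariance_eq_sub (memLp_coord m c S i) (memLp_coord m c S j)
  rw [covariance_sub_const_left (h i), covariance_sub_const_right (h j),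
    covariance_eval_multivariateGaussian hS, h1, h1] at h2
  have h3 : ∫ x, (x i - c i) * (x j - c j) ∂(multivariateGaussian m S) =
    ∫ x, ((fun x : Cfg n => x i - c i) * (fun x : Cfg n => x j - c j)) x
      ∂(multivariateGaussian m S) := rfl
  rw [h3]
  linarith

lemma quadForm_eq_sum (K : Matrix (Fin n) (Fin n) ℝ) (v : Fin n → ℝ) :
    v ⬝ᵥ K *ᵥ v = ∑ i, ∑ j, K i j * (v i * v j) := by
  simp only [dotProduct, mulVec, Finset.mul_sum]
  exact Finset.sum_congr rfl fun i _ => Finset.sum_congr rfl fun j _ => by ring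

lemma integrable_coord_mul_coord (m c : Cfg n) (S : Matrix (Fin n) (Fin n) ℝ) (i j : Fin n) :
    Integrable (fun x : Cfg n => (x i - c i) * (x j - c j)) (multivariateGaussian m S) :=
  (memLp_coord m c S i).integrable_mul (memLp_coord m c S j)

lemma integrable_quadForm (m c : Cfg n) (S K : Matrix (Fin n) (Fin n) ℝ) :
    Integrable (fun x : Cfg n => (x.ofLp - c.ofLp) ⬝ᵥ K *ᵥ (x.ofLp - c.ofLp)) (multivariateGaussian m S) := by
  simp only [quadForm_eq_sum]
  exact integrable_finsetSum _ fun i _ => integrable_finsetSum _ fun j _ =>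
    (integrable_coord_mul_coord m c S i j).const_mul _

lemma integral_quadForm (m c : Cfg n) {S : Matrix (Fin n) (Fin n) ℝ} (hS : S.PosSemidef)
    (K : Matrix (Fin n) (Fin n) ℝ) :
    ∫ x, (x.ofLp - c.ofLp) ⬝ᵥ K *ᵥ (x.ofLp - c.ofLp) ∂(multivariateGaussian m S) =
      (K * S).trace + (m.ofLp - c.ofLp) ⬝ᵥ K *ᵥ (m.ofLp - c.ofLp) := by
  simp only [quadForm_eq_sum]
  have hi : ∀ i j, Integrable (fun x : Cfg n => K i j * ((x.ofLp - c.ofLp) i * (x.ofLp - c.ofLp) j))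
      (multivariateGaussian m S) := fun i j => (integrable_coord_mul_coord m c S i j).const_mul _
  rw [integral_finsetSum _ fun i _ => integrable_finsetSum _ fun j _ => hi i j, trace,
    ← Finset.sum_add_distrib]
  refine Finset.sum_congr rfl fun i _ => ?_
  rw [integral_finsetSum _ fun j _ => hi i j, diag_apply, mul_apply, ← Finset.sum_add_distrib]
  refine Finset.sum_congr rfl fun j _ => ?_
  rw [integral_const_mul]
  have h := integral_coord_mul_coord m c hS i j
  simp only [Pi.sub_apply]
  -- The integral yields $S_{ij}$, the trace of the product $S_{ji}$; symmetry of `S` reconciles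
  -- them.
  rw [h, ← hS.1.apply i j]
  simp [mul_add]

lemma continuous_logGauss (m : Cfg n) (S : Matrix (Fin n) (Fin n) ℝ) :
    Continuous (logGauss m S) := by
  unfold logGauss
  simp only [quadForm_eq_sum]
  fun_prop

lemma multivariateGaussian_eq_withDensity_multivariateGaussian (m m' : Cfg n)
    {S S' : Matrix (Fin n) (Fin n) ℝ} (hS : S.PosDef) (hS' : S'.PosDef) :
    multivariateGaussian m S = (multivariateGaussian m' S').withDensity
      (fun x => ENNReal.ofReal (Real.exp (logGauss m S x - logGauss m' S' x))) := by
  have h1 := continuous_logGauss m S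
  have h2 := continuous_logGauss m' S'
  rw [multivariateGaussian_eq_withDensity m hS, multivariateGaussian_eq_withDensity m' hS',
    ← withDensity_mul _ (by fun_prop) (by fun_prop)]
  congr 1
  funext x
  rw [Pi.mul_apply, ← ENNReal.ofReal_mul (by positivity), Real.exp_sub]
  congr 1
  field_simp

/-- The exponent is the log-likelihood ratio. Equal total masses remove the mass correction in
`klDiv`, so only its expectation remains. -/
lemma klDiv_of_eq_withDensity_exp {α : Type*} [MeasurableSpace α] {μ ν : Measure α}
    [IsProbabilityMeasure μ] [IsProbabilityMeasure ν] {g : α → ℝ} (hg : Measurable g)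
    (he : μ = ν.withDensity fun x => ENNReal.ofReal (Real.exp (g x))) (hi : Integrable g μ) :
    InformationTheory.klDiv μ ν ≠ ⊤ ∧ (InformationTheory.klDiv μ ν).toReal = ∫ x, g x ∂μ := by
  have hac : μ ≪ ν := by
    rw [he]
    exact withDensity_absolutelyContinuous _ _
  have hllr : llr μ ν =ᵐ[μ] g := by
    have h := Measure.rnDeriv_withDensity ν
      (f := fun x => ENNReal.ofReal (Real.exp (g x))) (by fun_prop)
    rw [← he] at h
    filter_upwards [hac.ae_le h] with x hx
    rw [llr, hx, ENNReal.toReal_ofReal (Real.exp_pos _).le, Real.log_exp]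
  refine ⟨InformationTheory.klDiv_ne_top hac ((integrable_congr hllr).2 hi), ?_⟩
  rw [InformationTheory.toReal_klDiv_of_measure_eq hac (by simp), integral_congr_ae hllr]

lemma integrable_logGauss (m c : Cfg n) (S T : Matrix (Fin n) (Fin n) ℝ) :
    Integrable (logGauss c T) (multivariateGaussian m S) :=
  (((integrable_const _).add (integrable_quadForm m c S T⁻¹)).neg).div_const 2

lemma integral_logGauss (m c : Cfg n) {S : Matrix (Fin n) (Fin n) ℝ} (hS : S.PosSemidef)
    (T : Matrix (Fin n) (Fin n) ℝ) : ∫ x, logGauss c T x ∂(multivariateGaussian m S) =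
      -(Real.log T.det + ((T⁻¹ * S).trace +
        (m.ofLp - c.ofLp) ⬝ᵥ T⁻¹ *ᵥ (m.ofLp - c.ofLp))) / 2 := by
  unfold logGauss
  rw [integral_div, integral_neg, integral_add (integrable_const _)
    (integrable_quadForm m c S T⁻¹), integral_quadForm m c hS]
  simp

/-- The expectation of the difference of the two `logGauss` functions; the term $-n$ is the trace of
$S^{-1}S$. -/
lemma klDiv_multivariateGaussian (m m' : Cfg n) {S S' : Matrix (Fin n) (Fin n) ℝ}
    (hS : S.PosDef) (hS' : S'.PosDef) :
    InformationTheory.klDiv (multivariateGaussian m S) (multivariateGaussian m' S') ≠ ⊤ ∧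
    (InformationTheory.klDiv (multivariateGaussian m S) (multivariateGaussian m' S')).toReal =
      (Real.log (S'.det / S.det) - n + (S'⁻¹ * S).trace +
        (m.ofLp - m'.ofLp) ⬝ᵥ S'⁻¹ *ᵥ (m.ofLp - m'.ofLp)) / 2 := by
  have hi1 := integrable_logGauss m m S S
  have hi2 := integrable_logGauss m m' S S'
  have h := klDiv_of_eq_withDensity_exp
    ((continuous_logGauss m S).measurable.sub (continuous_logGauss m' S').measurable)
    (multivariateGaussian_eq_withDensity_multivariateGaussian m m' hS hS') (hi1.sub hi2)
  refine ⟨h.1, h.2.trans ?_⟩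
  simp only [Pi.sub_apply]
  rw [integral_sub hi1 hi2, integral_logGauss m m hS.posSemidef, integral_logGauss m m' hS.posSemidef,
    nonsing_inv_mul _ hS.det_pos.ne'.isUnit,
    Real.log_div hS'.det_pos.ne' hS.det_pos.ne', trace_one, sub_self, zero_dotProduct,
    Fintype.card_fin]
  ring

end QMeas

/-! ### The $L^2$ Fourier transform, translations, modulations and parity -/

namespace QMeas

open FourierTransform

variable {n : ℕ}

/-- The unitary Fourier transform on `L²(ℝⁿ)`. -/
noncomputable abbrev fourierL2 (n : ℕ) : Hil n ≃ₗᵢ[ℂ] Hil n := Lp.fourierTransformₗᵢ (Cfg n) ℂ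

/-- On `L¹ ∩ L²` the unitary Fourier transform is given by the Fourier integral. -/
lemma fourierL2_ae_eq (ψ : Hil n) (h : Integrable ψ) :
    fourierL2 n ψ =ᵐ[volume] 𝓕 (ψ : Cfg n → ℂ) := by
  have h1 : MemLp (ψ : Cfg n → ℂ) 1 := memLp_one_iff_integrable.2 h
  have hb : Continuous (𝓕 (ψ : Cfg n → ℂ)) := by
    rw [← Real.fourierTransform_toLp h1]
    exact BoundedContinuousFunction.continuous _
  -- Both sides are locally integrable, so testing against smooth compactly supported functions
  -- suffices. For such `g`, `e1` moves the $L^2$ transform onto `g` by its agreement with the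
  -- distributional transform, and `e2` does the same for the Fourier integral of an integrable
  -- function.
  refine ae_eq_of_integral_contDiff_smul_eq ((Lp.memLp _).locallyIntegrable (by norm_num))
    hb.locallyIntegrable fun g hg hgc => ?_
  have hg₁ : HasCompactSupport (Complex.ofRealCLM ∘ g) := hgc.comp_left rfl
  have hg₂ : ContDiff ℝ ((⊤ : ℕ∞) : WithTop ℕ∞) (Complex.ofRealCLM ∘ g) := by fun_prop
  set G : SchwartzMap (Cfg n) ℂ := hg₁.toSchwartzMap hg₂ with hG
  have e1 := congrArg (fun T => T G) (Lp.fourier_toTemperedDistribution_eq ψ)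
  simp only [TemperedDistribution.fourier_apply, Lp.toTemperedDistribution_apply] at e1
  have e2 := VectorFourier.integral_fourierIntegral_smul_eq_flip (μ := volume) (ν := volume)
    (L := innerₗ (Cfg n)) Real.continuous_fourierChar continuous_inner h (G.integrable (μ := volume))
  have e3 : ∀ x, G x = (g x : ℂ) := fun x => rfl
  simp only [e3] at e1 e2
  have e4 : ∫ x, g x • (fourierL2 n ψ : Cfg n → ℂ) x =
    ∫ x, (g x : ℂ) • (𝓕 ψ : Hil n) x := rfl
  rw [e4, ← e1, SchwartzMap.fourier_coe]
  rw [show (innerₗ (Cfg n)).flip = innerₗ (Cfg n) from LinearMap.ext₂ fun x y =>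
    real_inner_comm x y] at e2
  refine Eq.trans (integral_congr_ae (ae_of_all _ fun x => mul_comm _ _)) (e2.symm.trans ?_)
  exact integral_congr_ae (ae_of_all _ fun x => (mul_comm _ _).trans Complex.real_smul.symm)

/-- Schwartz functions are dense in $L^2$ and integrable. Closed conditions can therefore be checked
where the Fourier transform is an honest integral. -/
lemma hil_induction {P : Hil n → Prop} (hP : IsClosed {ψ | P ψ})
    (h : ∀ ψ : Hil n, Integrable ψ → P ψ) (ψ : Hil n) : P ψ := by
  refine DenseRange.induction_on (SchwartzMap.denseRange_toLpCLM (p := 2) (F := ℂ)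
    (μ := (volume : Measure (Cfg n))) ENNReal.ofNat_ne_top) ψ hP fun f => h _ ?_
  exact (f.integrable (μ := volume)).congr (f.coeFn_toLp 2 volume).symm

lemma transl_coe (q : Cfg n) (ψ : Hil n) : transl q ψ =ᵐ[volume] fun y => ψ (y - q) :=
  Lp.coeFn_compMeasurePreserving ψ (measurePreserving_sub_right volume q)

lemma parity_coe (ψ : Hil n) : parity ψ =ᵐ[volume] fun y => ψ (-y) :=
  Lp.coeFn_compMeasurePreserving ψ (Measure.measurePreserving_neg volume)

/-- Multiplication by the character `y ↦ exp(2πi k·y)`. -/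
noncomputable def modul (k : Cfg n) : Hil n →L[ℂ] Hil n :=
  mulOp (fun y => Complex.exp ((2 * Real.pi * ⟪k, y⟫ : ℝ) * Complex.I)) (by fun_prop)
    (fun _ => (Complex.norm_exp_ofReal_mul_I _).le)

lemma modul_coe (k : Cfg n) (ψ : Hil n) : modul k ψ =ᵐ[volume]
    fun y => Complex.exp ((2 * Real.pi * ⟪k, y⟫ : ℝ) * Complex.I) * ψ y :=
  mulOp_coe _ _ _ _

lemma fourierL2_transl (q : Cfg n) (ψ : Hil n) :
    fourierL2 n (transl q ψ) = modul (-q) (fourierL2 n ψ) := by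
  refine hil_induction (P := fun ψ => fourierL2 n (transl q ψ) = modul (-q) (fourierL2 n ψ))
    (isClosed_eq (by fun_prop) (by fun_prop)) (fun ψ h => Lp.ext ?_) ψ
  have hi : Integrable (transl q ψ) := (h.comp_sub_right q).congr (transl_coe q ψ).symm
  filter_upwards [fourierL2_ae_eq _ hi, fourierL2_ae_eq _ h, modul_coe (-q) (fourierL2 n ψ)]
    with ξ h1 h2 h3
  rw [h1, h3, h2, Real.fourier_congr_ae (transl_coe q ψ)]
  have := VectorFourier.fourierIntegral_comp_add_right Real.fourierChar volume
    (innerₗ (Cfg n)) (ψ : Cfg n → ℂ) (-q)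
  have := congrFun this ξ
  simp only [innerₗ_apply_apply, Circle.smul_def, Real.fourierChar_apply] at this
  convert! this using 2

lemma fourierL2_modul (k : Cfg n) (ψ : Hil n) :
    fourierL2 n (modul k ψ) = transl k (fourierL2 n ψ) := by
  refine hil_induction (P := fun ψ => fourierL2 n (modul k ψ) = transl k (fourierL2 n ψ))
    (isClosed_eq (by fun_prop) (by fun_prop)) (fun ψ h => Lp.ext ?_) ψ
  have hi : Integrable (modul k ψ) := by
    refine h.mono (Lp.aestronglyMeasurable _) ?_
    filter_upwards [modul_coe k ψ] with y hy
    rw [hy, norm_mul, Complex.norm_exp_ofReal_mul_I, one_mul]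
  have h2 := (measurePreserving_sub_right volume k).quasiMeasurePreserving.ae (fourierL2_ae_eq _ h)
  filter_upwards [fourierL2_ae_eq _ hi, h2, transl_coe k (fourierL2 n ψ)]
    with ξ h1 h2 h3
  rw [h1, h3, h2, Real.fourier_congr_ae (modul_coe k ψ), Real.fourier_eq', Real.fourier_eq']
  refine integral_congr_ae (ae_of_all _ fun y => ?_)
  simp only [smul_eq_mul]
  rw [← mul_assoc, ← Complex.exp_add, ← add_mul, ← Complex.ofReal_add, inner_sub_right,
    real_inner_comm k]
  congr 4
  ring

lemma fourierL2_parity (ψ : Hil n) : fourierL2 n (parity ψ) = parity (fourierL2 n ψ) := by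
  refine hil_induction (P := fun ψ => fourierL2 n (parity ψ) = parity (fourierL2 n ψ))
    (isClosed_eq (by fun_prop) (by fun_prop)) (fun ψ h => Lp.ext ?_) ψ
  have hi : Integrable (parity ψ) := h.comp_neg.congr (parity_coe ψ).symm
  have h2 := (Measure.measurePreserving_neg (volume : Measure (Cfg n))).quasiMeasurePreserving.ae
    (fourierL2_ae_eq _ h)
  filter_upwards [fourierL2_ae_eq _ hi, h2, parity_coe (fourierL2 n ψ)] with ξ h1 h2 h3
  rw [h1, h3, h2, Real.fourier_congr_ae (parity_coe ψ)]
  exact Real.fourier_comp_linearIsometry (LinearIsometryEquiv.neg ℝ) (ψ : Cfg n → ℂ) ξ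

end QMeas

/-! ### Weak integrals of positive operator densities -/

namespace QMeas

section WeakIntegral

variable {H : Type*} [NormedAddCommGroup H] [InnerProductSpace ℂ H]

lemma _root_.ContinuousLinearMap.IsPositive.inner_eq_re {T : H →L[ℂ] H} (hT : T.IsPositive)
    (φ : H) : inner ℂ φ (T φ) = ((inner ℂ φ (T φ)).re : ℂ) := by
  have h := ((ContinuousLinearMap.isPositive_iff_complex T).1 hT φ).1
  have h2 := hT.isSymmetric φ φ
  change inner ℂ (T φ) φ = inner ℂ φ (T φ) at h2
  rw [← h2]
  exact h.symm

/-- Positivity on $\varphi-c\psi$, with the phase $c$ chosen so that $c\langle\varphi,T\psi\rangle$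
is its own modulus. This additive form of Cauchy–Schwarz can be integrated term by term. -/
lemma _root_.ContinuousLinearMap.IsPositive.norm_inner_le {T : H →L[ℂ] H} (hT : T.IsPositive)
    (φ ψ : H) : 2 * ‖inner ℂ φ (T ψ)‖ ≤ (inner ℂ φ (T φ)).re + (inner ℂ ψ (T ψ)).re := by
  obtain ⟨c, hc, hc'⟩ := RCLike.exists_norm_eq_mul_self (inner ℂ φ (T ψ))
  have hs : inner ℂ ψ (T φ) = starRingEnd ℂ (inner ℂ φ (T ψ)) := by
    rw [inner_conj_symm]
    exact (hT.isSymmetric ψ φ).symm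
  have h := hT.re_inner_nonneg_right (φ - c • ψ)
  have hcc : starRingEnd ℂ c * c = 1 := by
    rw [Complex.conj_mul', hc]
    simp
  have e : inner ℂ (φ - c • ψ) (T (φ - c • ψ)) = inner ℂ φ (T φ) + inner ℂ ψ (T ψ)
      - (c * inner ℂ φ (T ψ) + starRingEnd ℂ (c * inner ℂ φ (T ψ))) := by
    simp only [map_sub, map_smul, inner_sub_left, inner_sub_right, inner_smul_left,
      inner_smul_right, hs, map_mul]
    linear_combination (inner ℂ ψ (T ψ)) * hcc
  rw [e, ← hc'] at h
  simp at h
  linarith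

lemma _root_.ContinuousLinearMap.IsPositive.inner_re_nonneg {T : H →L[ℂ] H} (hT : T.IsPositive)
    (φ : H) : 0 ≤ (inner ℂ φ (T φ)).re :=
  hT.re_inner_nonneg_right φ

/-- Rescaling both arguments to unit length turns the additive bound into a product bound. -/
lemma norm_sesq_le {f : H → H → ℂ} (hl : ∀ (c : ℂ) x y, f (c • x) y = starRingEnd ℂ c * f x y)
    (hr : ∀ (c : ℂ) x y, f x (c • y) = c * f x y)
    (h : ∀ x y, 2 * ‖f x y‖ ≤ ‖x‖ ^ 2 + ‖y‖ ^ 2) (x y : H) : ‖f x y‖ ≤ 1 * ‖x‖ * ‖y‖ := by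
  rcases eq_or_ne x 0 with rfl | hx
  · have := hl 0 0 y
    simp at this
    simp [this]
  rcases eq_or_ne y 0 with rfl | hy
  · have := hr 0 x 0
    simp at this
    simp [this]
  have hx' := norm_pos_iff.2 hx
  have hy' := norm_pos_iff.2 hy
  have := h ((‖x‖⁻¹ : ℂ) • x) ((‖y‖⁻¹ : ℂ) • y)
  rw [hl, hr, norm_smul, norm_smul, norm_mul, norm_mul, RCLike.norm_conj] at this
  simp only [norm_inv, Complex.norm_real, norm_norm] at this
  rw [inv_mul_cancel₀ hx'.ne', inv_mul_cancel₀ hy'.ne', ← mul_assoc, ← mul_assoc] at this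
  have h2 : ‖f x y‖ / (‖x‖ * ‖y‖) ≤ 1 := by
    rw [div_eq_mul_inv, mul_inv]
    linarith
  rw [div_le_one (by positivity)] at h2
  linarith

variable {X : Type*} [MeasurableSpace X] {μ : Measure X} {D : X → H →L[ℂ] H}

/-- Diagonal matrix elements are integrable because their total integral is $\|\varphi\|^2$; they
dominate the off-diagonal ones by `norm_inner_le`. -/
lemma integrable_inner_density (hpos : ∀ x, (D x).IsPositive)
    (hmeas : ∀ φ ψ, Measurable fun x => inner ℂ φ (D x ψ))
    (htot : ∀ φ, ∫⁻ x, ENNReal.ofReal (inner ℂ φ (D x φ)).re ∂μ = ‖φ‖ₑ ^ 2) (φ ψ : H) :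
    Integrable (fun x => inner ℂ φ (D x ψ)) μ := by
  have h : ∀ φ, Integrable (fun x => (inner ℂ φ (D x φ)).re) μ := fun φ => by
    refine ⟨(Complex.measurable_re.comp (hmeas φ φ)).aestronglyMeasurable, ?_⟩
    rw [hasFiniteIntegral_iff_ofReal (ae_of_all _ fun x => (hpos x).inner_re_nonneg φ), htot]
    exact ENNReal.pow_lt_top enorm_lt_top
  refine ((h φ).add (h ψ)).mono' (hmeas φ ψ).aestronglyMeasurable (ae_of_all _ fun x => ?_)
  have := (hpos x).norm_inner_le φ ψ
  have := norm_nonneg (inner ℂ φ (D x ψ))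
  simp only [Pi.add_apply]
  linarith

lemma integral_inner_density_self (hpos : ∀ x, (D x).IsPositive)
    (hmeas : ∀ φ ψ, Measurable fun x => inner ℂ φ (D x ψ))
    (htot : ∀ φ, ∫⁻ x, ENNReal.ofReal (inner ℂ φ (D x φ)).re ∂μ = ‖φ‖ₑ ^ 2) (φ : H) :
    ∫ x, (inner ℂ φ (D x φ)).re ∂μ = ‖φ‖ ^ 2 := by
  rw [integral_eq_lintegral_of_nonneg_ae
    (ae_of_all _ fun x => (hpos x).inner_re_nonneg φ)
    (Complex.measurable_re.comp (hmeas φ φ)).aestronglyMeasurable, htot]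
  simp

lemma ofReal_re_inner_of_isWeakIntegral (hpos : ∀ x, (D x).IsPositive) {Z : Set X}
    {T : H →L[ℂ] H} (hT : IsWeakIntegral D μ Z T) (φ : H) :
    ENNReal.ofReal (inner ℂ φ (T φ)).re =
      ∫⁻ x in Z, ENNReal.ofReal (inner ℂ φ (D x φ)).re ∂μ := by
  have hi : IntegrableOn (fun x => (inner ℂ φ (D x φ)).re) Z μ := (hT φ φ).1.re
  rw [← ofReal_integral_eq_lintegral_ofReal hi
    (ae_of_all _ fun x => (hpos x).inner_re_nonneg φ), (hT φ φ).2]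
  congr 1
  exact (Complex.reCLM.integral_comp_comm (hT φ φ).1).symm

variable [CompleteSpace H]

/-- A positive weakly measurable operator density integrating to the identity has a weak integral
over every set. -/
lemma exists_isWeakIntegral (hpos : ∀ x, (D x).IsPositive)
    (hmeas : ∀ φ ψ, Measurable fun x => inner ℂ φ (D x ψ))
    (htot : ∀ φ, ∫⁻ x, ENNReal.ofReal (inner ℂ φ (D x φ)).re ∂μ = ‖φ‖ₑ ^ 2) (Z : Set X) :
    ∃ T : H →L[ℂ] H, IsWeakIntegral D μ Z T := by
  have hi := integrable_inner_density hpos hmeas htot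
  let f : H → H → ℂ := fun φ ψ => ∫ x in Z, inner ℂ φ (D x ψ) ∂μ
  have h2 : ∀ (c : ℂ) x y, f (c • x) y = starRingEnd ℂ c * f x y := fun c x y => by
    simp only [f, inner_smul_left, integral_const_mul]
  have h4 : ∀ (c : ℂ) x y, f x (c • y) = c * f x y := fun c x y => by
    simp only [f, map_smul, inner_smul_right, integral_const_mul]
  let B : H →ₗ⋆[ℂ] H →ₗ[ℂ] ℂ := LinearMap.mk₂'ₛₗ (starRingEnd ℂ) (RingHom.id ℂ) f
    (fun x y z => by
      simp only [f, inner_add_left]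
      exact integral_add (hi _ _).integrableOn (hi _ _).integrableOn)
    h2
    (fun x y z => by
      simp only [f, map_add, inner_add_right]
      exact integral_add (hi _ _).integrableOn (hi _ _).integrableOn)
    h4
  have hb : ∀ x y, ‖B x y‖ ≤ 1 * ‖x‖ * ‖y‖ := norm_sesq_le h2 h4 fun φ ψ => by
    have hre : ∀ φ, Integrable (fun x => (inner ℂ φ (D x φ)).re) μ := fun φ => (hi φ φ).re
    calc 2 * ‖f φ ψ‖ ≤ 2 * ∫ x in Z, ‖inner ℂ φ (D x ψ)‖ ∂μ := by
          gcongr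
          exact norm_integral_le_integral_norm _
      _ ≤ 2 * ∫ x, ‖inner ℂ φ (D x ψ)‖ ∂μ := by
          gcongr 2 * ?_
          exact setIntegral_le_integral (hi φ ψ).norm (ae_of_all _ fun x => norm_nonneg _)
      _ = ∫ x, 2 * ‖inner ℂ φ (D x ψ)‖ ∂μ := (integral_const_mul _ _).symm
      _ ≤ ∫ x, ((inner ℂ φ (D x φ)).re + (inner ℂ ψ (D x ψ)).re) ∂μ :=
          integral_mono ((hi φ ψ).norm.const_mul 2) ((hre φ).add (hre ψ))
            fun x => (hpos x).norm_inner_le φ ψ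
      _ = ‖φ‖ ^ 2 + ‖ψ‖ ^ 2 := by
          rw [integral_add (hre φ) (hre ψ), integral_inner_density_self hpos hmeas htot,
            integral_inner_density_self hpos hmeas htot]
  -- The operator representing a bounded form stands in the first slot of the inner product, while a
  -- weak integral has it in the second; hence the adjoint.
  refine ⟨ContinuousLinearMap.adjoint
    (InnerProductSpace.continuousLinearMapOfBilin (B.mkContinuous₂ 1 hb)),
    fun φ ψ => ⟨(hi φ ψ).integrableOn, ?_⟩⟩
  rw [ContinuousLinearMap.adjoint_inner_right,
    InnerProductSpace.continuousLinearMapOfBilin_apply]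
  rfl

lemma exists_povm_isWeakIntegral (hpos : ∀ x, (D x).IsPositive)
    (hmeas : ∀ φ ψ, Measurable fun x => inner ℂ φ (D x ψ))
    (htot : ∀ φ, ∫⁻ x, ENNReal.ofReal (inner ℂ φ (D x φ)).re ∂μ = ‖φ‖ₑ ^ 2) :
    ∃ M : POVM X H, ∀ Z, MeasurableSet Z → IsWeakIntegral D μ Z (M.toFun Z) := by
  have hi := integrable_inner_density hpos hmeas htot
  choose T hT using exists_isWeakIntegral hpos hmeas htot
  have hre : ∀ Z φ, inner ℂ φ (T Z φ) = ((∫ x in Z, (inner ℂ φ (D x φ)).re ∂μ : ℝ) : ℂ) :=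
    fun Z φ => by
    rw [(hT Z φ φ).2, ← integral_complex_ofReal]
    exact integral_congr_ae (ae_of_all _ fun x => (hpos x).inner_eq_re φ)
  refine ⟨⟨T, fun Z _ => ?_, ?_, fun s hs hd φ ψ => ?_⟩, fun Z _ => hT Z⟩
  · rw [ContinuousLinearMap.isPositive_iff_complex]
    intro φ
    have h : inner ℂ (T Z φ) φ = ((∫ x in Z, (inner ℂ φ (D x φ)).re ∂μ : ℝ) : ℂ) := by
      rw [← inner_conj_symm, hre, Complex.conj_ofReal]
    rw [h]
    refine ⟨by simp, ?_⟩
    simp only [RCLike.re_to_complex, Complex.ofReal_re]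
    exact integral_nonneg fun x => (hpos x).inner_re_nonneg φ
  · refine ContinuousLinearMap.coe_injective ((ext_inner_map _ _).1 fun φ => ?_)
    change inner ℂ (T Set.univ φ) φ = inner ℂ φ φ
    rw [← inner_conj_symm, hre, Complex.conj_ofReal, setIntegral_univ,
      integral_inner_density_self hpos hmeas htot, inner_self_eq_norm_sq_to_K]
    norm_cast
  · simp only [(hT _ φ ψ).2]
    exact hasSum_integral_iUnion hs hd (hi φ ψ).integrableOn

/-- Distinct orthonormal vectors are at distance $\sqrt2\ge1$, so balls of radius $\frac12$ about
them are disjoint. Countability is needed to interchange sums over the basis with integrals. -/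
lemma countable_basisIndex (H : Type*) [NormedAddCommGroup H] [InnerProductSpace ℂ H]
    [CompleteSpace H] [TopologicalSpace.SeparableSpace H] : Countable (basisIndex H) := by
  have ho := (basis H).orthonormal
  have hd : Pairwise (Function.onFun Disjoint fun i => Metric.ball (basis H i) (1 / 2)) := by
    intro i j hij
    refine Metric.ball_disjoint_ball ?_
    have h := norm_sub_sq (𝕜 := ℂ) (basis H i) (basis H j)
    rw [ho.2 hij, ho.1, ho.1] at h
    simp only [map_zero, mul_zero, sub_zero] at h
    rw [dist_eq_norm]
    nlinarith [norm_nonneg (basis H i - basis H j)]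
  have := Set.PairwiseDisjoint.countable_of_isOpen (a := Set.univ) (hd.set_pairwise _)
    (fun i _ => Metric.isOpen_ball) (fun i _ => ⟨basis H i, by simp⟩)
  exact Set.countable_univ_iff.1 this

end WeakIntegral

end QMeas

/-! ### Phase-space amplitudes and Plancherel -/

namespace QMeas

open FourierTransform

variable {n : ℕ}

lemma measurable_hil (ψ : Hil n) : Measurable (ψ : Cfg n → ℂ) :=
  (Lp.stronglyMeasurable ψ).measurable

lemma lintegral_enorm_sq (ψ : Hil n) : ∫⁻ y, ‖ψ y‖ₑ ^ 2 = ‖ψ‖ₑ ^ 2 := by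
  rw [Lp.enorm_def]
  have h := eLpNorm_nnreal_pow_eq_lintegral (f := (ψ : Cfg n → ℂ)) (μ := volume)
    (p := 2) two_ne_zero
  simp only [NNReal.coe_ofNat, ENNReal.coe_ofNat, ENNReal.rpow_ofNat] at h
  exact h.symm

/-- Plancherel's identity for the Fourier integral on `L¹ ∩ L²`. -/
lemma lintegral_enorm_sq_fourier {f : Cfg n → ℂ} (h1 : Integrable f) (h2 : MemLp f 2) :
    ∫⁻ k, ‖𝓕 f k‖ₑ ^ 2 = ∫⁻ y, ‖f y‖ₑ ^ 2 := by
  have hc := h2.coeFn_toLp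
  have hF := fourierL2_ae_eq (h2.toLp f) (h1.congr hc.symm)
  have e1 : ∫⁻ k, ‖𝓕 f k‖ₑ ^ 2 = ∫⁻ k, ‖fourierL2 n (h2.toLp f) k‖ₑ ^ 2 := by
    refine lintegral_congr_ae ?_
    filter_upwards [hF] with k hk
    rw [hk, Real.fourier_congr_ae hc]
  have e2 : ∫⁻ y, ‖f y‖ₑ ^ 2 = ∫⁻ y, ‖h2.toLp f y‖ₑ ^ 2 := by
    refine lintegral_congr_ae ?_
    filter_upwards [hc] with k hk
    rw [hk]
  rw [e1, e2, lintegral_enorm_sq, lintegral_enorm_sq, ← ofReal_norm, ← ofReal_norm,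
    LinearIsometryEquiv.norm_map]

/-- The measure with density `|ψ|²`. -/
noncomputable def sqMeasure (ψ : Hil n) : Measure (Cfg n) :=
  volume.withDensity fun y => ‖ψ y‖ₑ ^ 2

lemma sqMeasure_univ (ψ : Hil n) : sqMeasure ψ Set.univ = ‖ψ‖ₑ ^ 2 := by
  rw [sqMeasure, withDensity_apply _ MeasurableSet.univ, setLIntegral_univ, lintegral_enorm_sq]

instance (ψ : Hil n) : IsFiniteMeasure (sqMeasure ψ) :=
  ⟨by rw [sqMeasure_univ]; exact ENNReal.pow_lt_top enorm_lt_top⟩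

lemma conv_sqMeasure_apply (u v : Hil n) {B : Set (Cfg n)} (hB : MeasurableSet B) :
    (sqMeasure u ∗ sqMeasure v) B = ∫⁻ q in B, ∫⁻ y, ‖u y‖ₑ ^ 2 * ‖v (q - y)‖ₑ ^ 2 := by
  have hu := measurable_hil u
  have hv := measurable_hil v
  have hm : Measurable (B.indicator (1 : Cfg n → ℝ≥0∞)) := measurable_one.indicator hB
  rw [← lintegral_indicator_one hB, Measure.lintegral_conv hm, sqMeasure,
    lintegral_withDensity_eq_lintegral_mul _ (by fun_prop)
      (by exact Measurable.lintegral_prod_right' (hm.comp measurable_add))]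
  have e1 : ∀ y, ((fun y => ‖u y‖ₑ ^ 2) * fun y => ∫⁻ z, B.indicator 1 (y + z) ∂sqMeasure v) y =
      ∫⁻ q, B.indicator 1 q * (‖u y‖ₑ ^ 2 * ‖v (q - y)‖ₑ ^ 2) := fun y => by
    rw [Pi.mul_apply, sqMeasure, lintegral_withDensity_eq_lintegral_mul _ (by fun_prop)
      (by exact hm.comp (measurable_const_add y)), ← lintegral_const_mul _ (by
        exact (by fun_prop : Measurable fun y => ‖v y‖ₑ ^ 2).mul (hm.comp (measurable_const_add y))),
      ← lintegral_sub_right_eq_self _ y]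
    refine lintegral_congr fun q => ?_
    simp only [Pi.mul_apply]
    rw [add_sub_cancel]
    ring
  simp only [e1]
  rw [lintegral_lintegral_swap]
  · rw [← lintegral_indicator hB]
    refine lintegral_congr fun q => ?_
    by_cases hq : q ∈ B <;> simp [hq]
  · refine Measurable.aemeasurable ?_
    exact (hm.comp measurable_snd).mul (((hu.comp measurable_fst).enorm.pow_const 2).mul
      ((hv.comp (measurable_snd.sub measurable_fst)).enorm.pow_const 2))

/-- For fixed $q$ the amplitude is a Fourier integral in $k$, ready for Plancherel. Reflection
followed by translation gives $v(q-y)$. -/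
lemma inner_modul_transl_parity (u v : Hil n) (q k : Cfg n) :
    inner ℂ u (modul k (transl q (parity v))) =
      𝓕 (fun y => starRingEnd ℂ (u y) * v (q - y)) (-k) := by
  rw [L2.inner_def, Real.fourier_eq']
  refine integral_congr_ae ?_
  have h := (measurePreserving_sub_right volume q).quasiMeasurePreserving.ae (parity_coe v)
  filter_upwards [modul_coe k (transl q (parity v)), transl_coe q (parity v), h] with y h1 h2 h3
  rw [h1, h2, h3, neg_sub, RCLike.inner_apply, smul_eq_mul, inner_neg_right, real_inner_comm y k]
  rw [show -2 * Real.pi * -⟪y, k⟫ = 2 * Real.pi * ⟪y, k⟫ by ring]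
  ring

/-- The phase space amplitude `⟪u, e^{2πi k·} v(q - ·)⟫` has the marginal density `|u|² ∗ |v|²` in `q`. -/
lemma lintegral_enorm_sq_inner_modul_transl_parity (u v : Hil n) {B : Set (Cfg n)}
    (hB : MeasurableSet B) :
    ∫⁻ q in B, ∫⁻ k, ‖inner ℂ u (modul k (transl q (parity v)))‖ₑ ^ 2 =
      (sqMeasure u ∗ sqMeasure v) B := by
  have hu := measurable_hil u
  have hv := measurable_hil v
  -- Plancherel is available on $L^1\cap L^2$. The product is in $L^1$ for every $q$ by Hölder, but
  -- in $L^2$ only for almost every $q$, by finiteness of the convolution's total mass.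
  have hfin : ∀ᵐ q, ∫⁻ y, ‖u y‖ₑ ^ 2 * ‖v (q - y)‖ₑ ^ 2 < ∞ := by
    refine ae_lt_top ?_ ?_
    · refine Measurable.lintegral_prod_right' (f := fun p : Cfg n × Cfg n =>
        ‖u p.2‖ₑ ^ 2 * ‖v (p.1 - p.2)‖ₑ ^ 2) ?_
      exact ((hu.comp measurable_snd).enorm.pow_const 2).mul
        ((hv.comp (measurable_fst.sub measurable_snd)).enorm.pow_const 2)
    · rw [← setLIntegral_univ, ← conv_sqMeasure_apply u v MeasurableSet.univ]
      exact measure_ne_top _ _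
  rw [conv_sqMeasure_apply u v hB]
  refine lintegral_congr_ae (ae_restrict_of_ae ?_)
  filter_upwards [hfin] with q hq
  have hw : MemLp (fun y => v (q - y)) 2 :=
    (Lp.memLp v).comp_measurePreserving (Measure.measurePreserving_sub_left volume q)
  have hs : MemLp (fun y => starRingEnd ℂ (u y)) 2 := (Lp.memLp u).star
  have e : ∀ y, ‖starRingEnd ℂ (u y) * v (q - y)‖ₑ ^ 2 = ‖u y‖ₑ ^ 2 * ‖v (q - y)‖ₑ ^ 2 :=
    fun y => by rw [enorm_mul, mul_pow, RCLike.enorm_conj]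
  have h1 : Integrable fun y => starRingEnd ℂ (u y) * v (q - y) := hs.integrable_mul hw
  have h2 : MemLp (fun y => starRingEnd ℂ (u y) * v (q - y)) 2 := by
    refine ⟨h1.1, ?_⟩
    have h := eLpNorm_nnreal_pow_eq_lintegral (f := fun y => starRingEnd ℂ (u y) * v (q - y))
      (μ := volume) (p := 2) two_ne_zero
    simp only [NNReal.coe_ofNat, ENNReal.coe_ofNat, ENNReal.rpow_ofNat, e] at h
    rw [← h] at hq
    exact (ENNReal.pow_lt_top_iff.1 hq).resolve_right two_ne_zero
  simp only [inner_modul_transl_parity]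
  rw [(Measure.measurePreserving_neg (volume : Measure (Cfg n))).lintegral_comp_emb
    (MeasurableEquiv.neg (Cfg n)).measurableEmbedding
    (fun k => ‖𝓕 (fun y => starRingEnd ℂ (u y) * v (q - y)) k‖ₑ ^ 2),
    lintegral_enorm_sq_fourier h1 h2]
  simp only [e]

end QMeas

/-! ### Weyl operators and the marginals of their matrix elements -/

namespace QMeas

variable {n : ℕ} {ħ : ℝ}

lemma weyl_coe (ħ : ℝ) (x p : Cfg n) (χ : Hil n) : weyl ħ x p χ =ᵐ[volume] fun y =>
    Complex.exp (((⟪p, y⟫ - ⟪x, p⟫ / 2) / ħ : ℝ) * Complex.I) * χ (y - x) := by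
  filter_upwards [mulOp_coe (fun y => Complex.exp (((⟪p, y⟫ - ⟪x, p⟫ / 2) / ħ : ℝ) * Complex.I))
    (by fun_prop) (fun y => (Complex.norm_exp_ofReal_mul_I _).le) (transl x χ),
    transl_coe x χ] with y h1 h2
  rw [← h2, ← h1]
  rfl

/-- The factor $2\pi$ in `modul` turns the wave vector $p/\hbar$ into the frequency $p/(2\pi\hbar)$.
The scalar phase disappears from all moduli. -/
lemma weyl_eq_modul_transl (hħ : ħ ≠ 0) (x p : Cfg n) (χ : Hil n) :
    weyl ħ x p χ = Complex.exp ((-(⟪x, p⟫ / 2 / ħ) : ℝ) * Complex.I) •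
      modul ((2 * Real.pi * ħ)⁻¹ • p) (transl x χ) := by
  refine Lp.ext ?_
  filter_upwards [weyl_coe ħ x p χ, Lp.coeFn_smul
    (Complex.exp ((-(⟪x, p⟫ / 2 / ħ) : ℝ) * Complex.I))
    (modul ((2 * Real.pi * ħ)⁻¹ • p) (transl x χ)),
    modul_coe ((2 * Real.pi * ħ)⁻¹ • p) (transl x χ), transl_coe x χ] with y h1 h2 h3 h4
  rw [h1, h2, Pi.smul_apply, h3, h4, smul_eq_mul, ← mul_assoc, ← Complex.exp_add, ← add_mul,
    ← Complex.ofReal_add, real_inner_smul_left]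
  congr 4
  field_simp
  ring

lemma transl_modul (k m : Cfg n) (ψ : Hil n) : transl k (modul m ψ) =
    Complex.exp ((-(2 * Real.pi * ⟪m, k⟫) : ℝ) * Complex.I) • modul m (transl k ψ) := by
  refine Lp.ext ?_
  have h := (measurePreserving_sub_right volume k).quasiMeasurePreserving.ae (modul_coe m ψ)
  filter_upwards [transl_coe k (modul m ψ), h, Lp.coeFn_smul
    (Complex.exp ((-(2 * Real.pi * ⟪m, k⟫) : ℝ) * Complex.I)) (modul m (transl k ψ)),
    modul_coe m (transl k ψ), transl_coe k ψ] with y h1 h2 h3 h4 h5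
  rw [h1, h2, h3, Pi.smul_apply, h4, h5, smul_eq_mul, ← mul_assoc, ← Complex.exp_add, ← add_mul,
    ← Complex.ofReal_add, inner_sub_right]
  congr 4
  ring

lemma enorm_inner_phase_smul (t : ℝ) (φ χ : Hil n) :
    ‖inner ℂ φ (Complex.exp (t * Complex.I) • χ)‖ₑ = ‖inner ℂ φ χ‖ₑ := by
  rw [inner_smul_right, enorm_mul, ← ofReal_norm (Complex.exp _), Complex.norm_exp_ofReal_mul_I,
    ENNReal.ofReal_one, one_mul]

lemma enorm_inner_weyl (hħ : ħ ≠ 0) (x p : Cfg n) (φ χ : Hil n) :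
    ‖inner ℂ φ (weyl ħ x p χ)‖ₑ =
      ‖inner ℂ φ (modul ((2 * Real.pi * ħ)⁻¹ • p) (transl x χ))‖ₑ := by
  rw [weyl_eq_modul_transl hħ, enorm_inner_phase_smul]

/-- In the Fourier picture $p$ translates and $x$ modulates, so the momentum marginal becomes a
position marginal for the transformed vectors. -/
lemma enorm_inner_weyl_fourierL2 (hħ : ħ ≠ 0) (x p : Cfg n) (φ χ : Hil n) :
    ‖inner ℂ φ (weyl ħ x p χ)‖ₑ = ‖inner ℂ (fourierL2 n φ)
      (modul (-x) (transl ((2 * Real.pi * ħ)⁻¹ • p) (fourierL2 n χ)))‖ₑ := by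
  rw [enorm_inner_weyl hħ, ← (fourierL2 n).inner_map_map, fourierL2_modul, fourierL2_transl,
    transl_modul, enorm_inner_phase_smul]

lemma measurable_inner_weyl (ħ : ℝ) (φ χ : Hil n) :
    Measurable fun z : Cfg n × Cfg n => inner ℂ φ (weyl ħ z.1 z.2 χ) := by
  have hφ := measurable_hil φ
  have hχ := measurable_hil χ
  have e : (fun z : Cfg n × Cfg n => inner ℂ φ (weyl ħ z.1 z.2 χ)) = fun z => ∫ y,
      Complex.exp (((⟪z.2, y⟫ - ⟪z.1, z.2⟫ / 2) / ħ : ℝ) * Complex.I) * χ (y - z.1) *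
        starRingEnd ℂ (φ y) := by
    funext z
    rw [L2.inner_def]
    refine integral_congr_ae ?_
    filter_upwards [weyl_coe ħ z.1 z.2 χ] with y hy
    rw [hy, RCLike.inner_apply]
  rw [e]
  refine (StronglyMeasurable.integral_prod_right' (f := fun w : (Cfg n × Cfg n) × Cfg n =>
    Complex.exp (((⟪w.1.2, w.2⟫ - ⟪w.1.1, w.1.2⟫ / 2) / ħ : ℝ) * Complex.I) * χ (w.2 - w.1.1) *
        starRingEnd ℂ (φ w.2)) (Measurable.stronglyMeasurable ?_)).measurable
  refine Measurable.mul (Measurable.mul (by fun_prop) (hχ.comp (by fun_prop))) ?_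
  exact Complex.continuous_conj.measurable.comp (hφ.comp measurable_snd)

lemma lintegral_comp_inv_smul {c : ℝ} (hc : 0 < c) (g : Cfg n → ℝ≥0∞) :
    ∫⁻ p, g (c⁻¹ • p) = ENNReal.ofReal (c ^ n) * ∫⁻ q, g q := by
  have hc' : c⁻¹ ≠ 0 := (inv_pos.2 hc).ne'
  have h := Measure.map_addHaar_smul (volume : Measure (Cfg n)) hc'
  rw [finrank_euclideanSpace_fin, inv_pow, inv_inv, abs_of_pos (by positivity)] at h
  rw [← smul_eq_mul, ← lintegral_smul_measure, ← h]
  exact ((Homeomorph.smulOfNeZero c⁻¹ hc').measurableEmbedding.lintegral_map g).symm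

lemma setLIntegral_comp_inv_smul {c : ℝ} (hc : 0 < c) (g : Cfg n → ℝ≥0∞) {B : Set (Cfg n)}
    (hB : MeasurableSet B) : ∫⁻ p in B, g (c⁻¹ • p) =
      ENNReal.ofReal (c ^ n) * ∫⁻ q in (fun q : Cfg n => c • q) ⁻¹' B, g q := by
  have hm : MeasurableSet ((fun q : Cfg n => c • q) ⁻¹' B) :=
    (measurable_const_smul c) hB
  rw [← lintegral_indicator hB, ← lintegral_indicator hm, ← lintegral_comp_inv_smul hc]
  refine lintegral_congr fun p => ?_
  have hp : c⁻¹ • p ∈ (fun q : Cfg n => c • q) ⁻¹' B ↔ p ∈ B := by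
    rw [Set.mem_preimage, smul_inv_smul₀ hc.ne']
  by_cases h : p ∈ B
  · rw [Set.indicator_of_mem h, Set.indicator_of_mem (hp.2 h)]
  · rw [Set.indicator_of_notMem h, Set.indicator_of_notMem (hp.not.2 h)]

/-- The factor $(2\pi\hbar)^n$ comes from substituting $k=p/(2\pi\hbar)$; it cancels the
normalisation in `covDensity`. -/
lemma lintegral_weyl_fst (hħ : 0 < ħ) (φ s : Hil n) {B : Set (Cfg n)} (hB : MeasurableSet B) :
    ∫⁻ z in Prod.fst ⁻¹' B, ‖inner ℂ φ (weyl ħ z.1 z.2 (parity s))‖ₑ ^ 2 =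
      ENNReal.ofReal ((2 * Real.pi * ħ) ^ n) * (sqMeasure φ ∗ sqMeasure s) B := by
  have hm := ((measurable_inner_weyl ħ φ (parity s)).enorm.pow_const 2)
  rw [← Set.prod_univ, Measure.volume_eq_prod, setLIntegral_prod _ hm.aemeasurable]
  simp only [enorm_inner_weyl hħ.ne', setLIntegral_univ]
  rw [← lintegral_enorm_sq_inner_modul_transl_parity φ s hB, ← lintegral_const_mul' _ _
    ENNReal.ofReal_ne_top]
  refine lintegral_congr fun x => ?_
  exact lintegral_comp_inv_smul (by positivity)
    fun k => ‖inner ℂ φ (modul k (transl x (parity s)))‖ₑ ^ 2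

lemma lintegral_weyl_snd (hħ : 0 < ħ) (φ s : Hil n) {B : Set (Cfg n)} (hB : MeasurableSet B) :
    ∫⁻ z in Prod.snd ⁻¹' B, ‖inner ℂ φ (weyl ħ z.1 z.2 (parity s))‖ₑ ^ 2 =
      ENNReal.ofReal ((2 * Real.pi * ħ) ^ n) *
        (sqMeasure (fourierL2 n φ) ∗ sqMeasure (fourierL2 n s))
          ((fun q : Cfg n => (2 * Real.pi * ħ) • q) ⁻¹' B) := by
  have hm := ((measurable_inner_weyl ħ φ (parity s)).enorm.pow_const 2)
  have hc : 0 < 2 * Real.pi * ħ := by positivity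
  rw [← Set.univ_prod, Measure.volume_eq_prod, setLIntegral_prod_symm _ hm.aemeasurable]
  simp only [enorm_inner_weyl_fourierL2 hħ.ne', setLIntegral_univ]
  rw [← lintegral_enorm_sq_inner_modul_transl_parity _ _ (measurable_const_smul _ hB),
    ← setLIntegral_comp_inv_smul hc _ hB]
  refine lintegral_congr fun p => ?_
  rw [fourierL2_parity]
  -- Lebesgue measure is invariant under reflection, which absorbs the sign in `modul (-x)`.
  exact (Measure.measurePreserving_neg (volume : Measure (Cfg n))).lintegral_comp_emb
    (MeasurableEquiv.neg (Cfg n)).measurableEmbedding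
    fun k => ‖inner ℂ (fourierL2 n φ) (modul k (transl ((2 * Real.pi * ħ)⁻¹ • p)
      (parity (fourierL2 n s))))‖ₑ ^ 2

end QMeas

/-! ### The covariant observable and its marginals as convolutions -/

namespace QMeas

variable {n : ℕ} {ħ : ℝ}

lemma parity_parity (ψ : Hil n) : parity (parity ψ) = ψ := by
  refine Lp.ext ?_
  have h := (Measure.measurePreserving_neg (volume : Measure (Cfg n))).quasiMeasurePreserving.ae
    (parity_coe ψ)
  filter_upwards [parity_coe (parity ψ), h] with y h1 h2
  rw [h1, h2, neg_neg]

lemma inner_parity_left (φ ψ : Hil n) : inner ℂ (parity φ) ψ = inner ℂ φ (parity ψ) := by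
  rw [← LinearIsometry.inner_map_map (Lp.compMeasurePreservingₗᵢ ℂ (fun y : Cfg n => -y)
    (Measure.measurePreserving_neg volume)) (parity φ) ψ]
  change inner ℂ (parity (parity φ)) (parity ψ) = _
  rw [parity_parity]

/-- The vectors `√σ bₖ`, with `σ = ∑ₖ |√σ bₖ⟩⟨√σ bₖ|`. -/
noncomputable def State.ket (σ : State (Hil n)) (k : basisIndex (Hil n)) : Hil n :=
  σ.sqrtOp (basis (Hil n) k)

/-- Parseval, inserted between the two factors of $\sigma=\sqrt\sigma\sqrt\sigma$, reduces a mixed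
state to rank one amplitudes. -/
lemma hasSum_inner_covDensity (ħ : ℝ) (σ : State (Hil n)) (z : Cfg n × Cfg n) (φ ψ : Hil n) :
    HasSum (fun k => (((2 * Real.pi * ħ) ^ n)⁻¹ : ℂ) *
      (inner ℂ φ (weyl ħ z.1 z.2 (parity (σ.ket k))) *
        inner ℂ (weyl ħ z.1 z.2 (parity (σ.ket k))) ψ)) (inner ℂ φ (covDensity ħ σ z ψ)) := by
  set W := weyl (n := n) ħ z.1 z.2
  have e : inner ℂ φ (covDensity ħ σ z ψ) = (((2 * Real.pi * ħ) ^ n)⁻¹ : ℂ) *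
      inner ℂ (σ.sqrtOp (parity (ContinuousLinearMap.adjoint W φ)))
        (σ.sqrtOp (parity (ContinuousLinearMap.adjoint W ψ))) := by
    rw [σ.sqrtOp_symm, σ.sqrtOp_sq, inner_parity_left, ContinuousLinearMap.adjoint_inner_left,
      ← inner_smul_right]
    rfl
  have e1 : ∀ φ k, inner ℂ (σ.sqrtOp (parity (ContinuousLinearMap.adjoint W φ)))
      (basis (Hil n) k) = inner ℂ φ (W (parity (σ.ket k))) := fun φ k => by
    rw [σ.sqrtOp_symm, inner_parity_left, ContinuousLinearMap.adjoint_inner_left]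
    rfl
  have e2 : ∀ k, inner ℂ (W (parity (σ.ket k))) ψ = inner ℂ (basis (Hil n) k)
      (σ.sqrtOp (parity (ContinuousLinearMap.adjoint W ψ))) := fun k => by
    rw [← inner_conj_symm, ← e1, inner_conj_symm]
  rw [e]
  refine HasSum.mul_left _ ?_
  simp only [e2, ← e1]
  exact (basis (Hil n)).hasSum_inner_mul_inner _ _

lemma ofReal_inner_covDensity (hħ : 0 < ħ) (σ : State (Hil n)) (z : Cfg n × Cfg n) (φ : Hil n) :
    ENNReal.ofReal (inner ℂ φ (covDensity ħ σ z φ)).re = ∑' k,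
      ENNReal.ofReal ((2 * Real.pi * ħ) ^ n)⁻¹ *
        ‖inner ℂ φ (weyl ħ z.1 z.2 (parity (σ.ket k)))‖ₑ ^ 2 := by
  have h := Complex.reCLM.hasSum (hasSum_inner_covDensity ħ σ z φ φ)
  have e : ∀ k, Complex.reCLM ((((2 * Real.pi * ħ) ^ n)⁻¹ : ℂ) *
      (inner ℂ φ (weyl ħ z.1 z.2 (parity (σ.ket k))) *
        inner ℂ (weyl ħ z.1 z.2 (parity (σ.ket k))) φ)) = ((2 * Real.pi * ħ) ^ n)⁻¹ *
      ‖inner ℂ φ (weyl ħ z.1 z.2 (parity (σ.ket k)))‖ ^ 2 := fun k => by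
    rw [← inner_conj_symm (weyl ħ z.1 z.2 (parity (σ.ket k))) φ, Complex.mul_conj',
      Complex.reCLM_apply]
    norm_cast
  simp only [e] at h
  change ENNReal.ofReal (Complex.reCLM (inner ℂ φ (covDensity ħ σ z φ))) = _
  rw [← h.tsum_eq, ENNReal.ofReal_tsum_of_nonneg (fun k => by positivity) h.summable]
  refine tsum_congr fun k => ?_
  rw [ENNReal.ofReal_mul (by positivity), ENNReal.ofReal_pow (norm_nonneg _), ofReal_norm]

lemma isPositive_covDensity (hħ : 0 < ħ) (σ : State (Hil n)) (z : Cfg n × Cfg n) :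
    (covDensity ħ σ z).IsPositive := by
  have h0 : (parity (n := n)).adjoint = parity := by
    refine ContinuousLinearMap.ext fun φ => ext_inner_left ℂ fun ψ => ?_
    rw [ContinuousLinearMap.adjoint_inner_right, inner_parity_left]
  have h := σ.pos.conj_adjoint (weyl ħ z.1 z.2 ∘L parity)
  rw [ContinuousLinearMap.adjoint_comp, h0] at h
  have e : covDensity ħ σ z = ((((2 * Real.pi * ħ) ^ n)⁻¹ : ℝ) : ℂ) •
      ((weyl ħ z.1 z.2 ∘L parity) ∘L σ.op ∘L (parity ∘L (weyl ħ z.1 z.2).adjoint)) := by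
    rw [covDensity]
    push_cast
    rfl
  rw [e]
  exact h.smul_of_nonneg (by
    rw [Complex.zero_le_real]
    positivity)

instance : TopologicalSpace.SeparableSpace (Hil n) :=
  have : Fact ((2 : ℝ≥0∞) ≠ ∞) := ⟨ENNReal.ofNat_ne_top⟩
  inferInstance

lemma measurable_inner_covDensity (ħ : ℝ) (σ : State (Hil n)) (φ ψ : Hil n) :
    Measurable fun z => inner ℂ φ (covDensity ħ σ z ψ) := by
  have := countable_basisIndex (Hil n)
  have h := fun z => hasSum_inner_covDensity ħ σ z φ ψ
  refine measurable_of_tendsto_metrizable' Filter.atTop (f := fun (s : Finset _) z => ∑ k ∈ s, _)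
    (fun s => ?_) (tendsto_pi_nhds.2 h)
  refine Finset.measurable_sum _ fun k _ => ?_
  have h1 := measurable_inner_weyl ħ φ (parity (σ.ket k))
  have h2 := Complex.continuous_conj.measurable.comp (measurable_inner_weyl ħ ψ (parity (σ.ket k)))
  refine (h1.mul ((congrArg Measurable (funext fun z => ?_)).mp h2)).const_mul _
  exact inner_conj_symm _ _

lemma setLIntegral_covDensity (hħ : 0 < ħ) (σ : State (Hil n)) (φ : Hil n)
    (Z : Set (Cfg n × Cfg n)) :
    ∫⁻ z in Z, ENNReal.ofReal (inner ℂ φ (covDensity ħ σ z φ)).re =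
      ∑' k, ENNReal.ofReal ((2 * Real.pi * ħ) ^ n)⁻¹ *
        ∫⁻ z in Z, ‖inner ℂ φ (weyl ħ z.1 z.2 (parity (σ.ket k)))‖ₑ ^ 2 := by
  have := countable_basisIndex (Hil n)
  have hm := fun k => (measurable_inner_weyl ħ φ (parity (σ.ket k))).enorm.pow_const 2
  simp only [ofReal_inner_covDensity hħ]
  rw [lintegral_tsum fun k => ((hm k).const_mul _).aemeasurable]
  exact tsum_congr fun k => lintegral_const_mul _ (hm k)

lemma ofReal_inv_mul_ofReal_mul {c : ℝ} (hc : 0 < c) (x : ℝ≥0∞) :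
    ENNReal.ofReal c⁻¹ * (ENNReal.ofReal c * x) = x := by
  rw [← mul_assoc, ← ENNReal.ofReal_mul (inv_pos.2 hc).le, inv_mul_cancel₀ hc.ne',
    ENNReal.ofReal_one, one_mul]

lemma setLIntegral_covDensity_fst (hħ : 0 < ħ) (σ : State (Hil n)) (φ : Hil n)
    {B : Set (Cfg n)} (hB : MeasurableSet B) :
    ∫⁻ z in Prod.fst ⁻¹' B, ENNReal.ofReal (inner ℂ φ (covDensity ħ σ z φ)).re =
      ∑' k, (sqMeasure φ ∗ sqMeasure (σ.ket k)) B := by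
  rw [setLIntegral_covDensity hħ]
  refine tsum_congr fun k => ?_
  rw [lintegral_weyl_fst hħ _ _ hB, ofReal_inv_mul_ofReal_mul (by positivity)]

lemma setLIntegral_covDensity_snd (hħ : 0 < ħ) (σ : State (Hil n)) (φ : Hil n)
    {B : Set (Cfg n)} (hB : MeasurableSet B) :
    ∫⁻ z in Prod.snd ⁻¹' B, ENNReal.ofReal (inner ℂ φ (covDensity ħ σ z φ)).re =
      ∑' k, (sqMeasure (fourierL2 n φ) ∗ sqMeasure (fourierL2 n (σ.ket k)))
        ((fun q : Cfg n => (2 * Real.pi * ħ) • q) ⁻¹' B) := by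
  rw [setLIntegral_covDensity hħ]
  refine tsum_congr fun k => ?_
  rw [lintegral_weyl_snd hħ _ _ hB, ofReal_inv_mul_ofReal_mul (by positivity)]

lemma State.tsum_enorm_ket (σ : State (Hil n)) : ∑' k, ‖σ.ket k‖ₑ ^ 2 = 1 := by
  have h := σ.ofReal_tr (T := 1) ContinuousLinearMap.isPositive_one
  rw [mul_one, σ.tr_one, Complex.one_re, ENNReal.ofReal_one] at h
  rw [h]
  refine tsum_congr fun k => ?_
  change _ = ENNReal.ofReal (inner ℂ (σ.ket k) (σ.ket k)).re
  rw [inner_self_eq_norm_sq_to_K, ← ofReal_norm, ← ENNReal.ofReal_pow (norm_nonneg _)]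
  norm_cast

lemma conv_sqMeasure_univ (u v : Hil n) :
    (sqMeasure u ∗ sqMeasure v) Set.univ = ‖u‖ₑ ^ 2 * ‖v‖ₑ ^ 2 := by
  rw [Measure.conv, Measure.map_apply measurable_add MeasurableSet.univ, Set.preimage_univ,
    ← Set.univ_prod_univ, Measure.prod_prod, sqMeasure_univ, sqMeasure_univ]

/-- The marginal formula over the whole space gives $\|\varphi\|^2\,\mathrm{Tr}\,\sigma$. This is
the resolution of the identity required by `exists_povm_isWeakIntegral`. -/
lemma lintegral_covDensity (hħ : 0 < ħ) (σ : State (Hil n)) (φ : Hil n) :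
    ∫⁻ z, ENNReal.ofReal (inner ℂ φ (covDensity ħ σ z φ)).re = ‖φ‖ₑ ^ 2 := by
  rw [← setLIntegral_univ, ← Set.preimage_univ (f := Prod.fst),
    setLIntegral_covDensity_fst hħ σ φ MeasurableSet.univ]
  simp only [conv_sqMeasure_univ]
  rw [ENNReal.tsum_mul_left, σ.tsum_enorm_ket, mul_one]

/-- The covariant observable is given by the weak integrals of its density. -/
lemma isWeakIntegral_covObs (hħ : 0 < ħ) (σ : State (Hil n)) {Z : Set (Cfg n × Cfg n)}
    (hZ : MeasurableSet Z) : IsWeakIntegral (covDensity ħ σ) volume Z ((covObs ħ σ).toFun Z) := by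
  have h := exists_povm_isWeakIntegral (isPositive_covDensity hħ σ)
    (measurable_inner_covDensity ħ σ) (lintegral_covDensity hħ σ)
  rw [covObs, dif_pos h]
  exact h.choose_spec Z hZ

/-- The measure `∑ⱼ |rⱼ|²`. -/
noncomputable def sumSqMeasure {ι : Type*} (r : ι → Hil n) : Measure (Cfg n) :=
  Measure.sum fun j => sqMeasure (r j)

lemma conv_sumSqMeasure_apply {ι κ : Type*} [Countable ι] [Countable κ] (r : ι → Hil n)
    (s : κ → Hil n) {B : Set (Cfg n)} (hB : MeasurableSet B) :
    (sumSqMeasure r ∗ sumSqMeasure s) B = ∑' j, ∑' k, (sqMeasure (r j) ∗ sqMeasure (s k)) B := by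
  simp only [sumSqMeasure, Measure.conv, Measure.map_apply measurable_add hB]
  rw [Measure.prod_sum, Measure.sum_apply _ (measurable_add hB), ENNReal.tsum_prod']

lemma State.outcome_covObs_fst (hħ : 0 < ħ) (ρ σ : State (Hil n)) :
    ρ.outcome ((covObs ħ σ).map Prod.fst measurable_fst) =
      sumSqMeasure ρ.ket ∗ sumSqMeasure σ.ket := by
  have := countable_basisIndex (Hil n)
  ext B hB
  rw [ρ.outcome_apply _ hB, ρ.ofReal_tr (POVM.pos _ _ hB), conv_sumSqMeasure_apply _ _ hB]
  refine tsum_congr fun j => ?_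
  rw [← setLIntegral_covDensity_fst hħ σ _ hB]
  exact ofReal_re_inner_of_isWeakIntegral (isPositive_covDensity hħ σ)
    (isWeakIntegral_covObs hħ σ (measurable_fst hB)) _

lemma State.outcome_covObs_snd (hħ : 0 < ħ) (ρ σ : State (Hil n)) :
    ρ.outcome ((covObs ħ σ).map Prod.snd measurable_snd) =
      (sumSqMeasure (fourierL2 n ∘ ρ.ket) ∗ sumSqMeasure (fourierL2 n ∘ σ.ket)).map
        (fun q => (2 * Real.pi * ħ) • q) := by
  have := countable_basisIndex (Hil n)
  ext B hB
  rw [ρ.outcome_apply _ hB, ρ.ofReal_tr (POVM.pos _ _ hB),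
    Measure.map_apply (measurable_const_smul _) hB,
    conv_sumSqMeasure_apply _ _ (measurable_const_smul _ hB)]
  refine tsum_congr fun j => ?_
  simp only [Function.comp_apply]
  rw [← setLIntegral_covDensity_snd hħ σ _ hB]
  exact ofReal_re_inner_of_isWeakIntegral (isPositive_covDensity hħ σ)
    (isWeakIntegral_covObs hħ σ (measurable_snd hB)) _

lemma ofReal_re_inner_mulOp_indicator {B : Set (Cfg n)} (hB : MeasurableSet B) (φ : Hil n) :
    ENNReal.ofReal (inner ℂ φ ((posObs n).toFun B φ)).re = sqMeasure φ B := by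
  have e : (posObs n).toFun B = mulOp (B.indicator 1) (measurable_one.indicator hB)
      (fun y => by by_cases h : y ∈ B <;> simp [h]) := dif_pos hB
  have h : ∀ y, inner ℂ (φ y) (φ y) = ((‖φ y‖ ^ 2 : ℝ) : ℂ) := fun y => by
    rw [inner_self_eq_norm_sq_to_K]
    norm_cast
  rw [e, inner_mulOp_indicator hB]
  simp only [h]
  rw [integral_complex_ofReal, Complex.ofReal_re, ofReal_integral_eq_lintegral_ofReal
    ((Lp.memLp φ).integrable_norm_pow two_ne_zero).integrableOn (ae_of_all _ fun y => sq_nonneg _),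
    sqMeasure, withDensity_apply _ hB]
  refine lintegral_congr fun y => ?_
  rw [ENNReal.ofReal_pow (norm_nonneg _), ofReal_norm]

lemma State.outcome_posObs (ρ : State (Hil n)) :
    ρ.outcome (posObs n) = sumSqMeasure ρ.ket := by
  ext B hB
  rw [ρ.outcome_apply _ hB, ρ.ofReal_tr (POVM.pos _ _ hB), sumSqMeasure, Measure.sum_apply _ hB]
  exact tsum_congr fun j => ofReal_re_inner_mulOp_indicator hB _

lemma State.outcome_momObs (ħ : ℝ) (ρ : State (Hil n)) :
    ρ.outcome (momObs ħ n) =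
      (sumSqMeasure (fourierL2 n ∘ ρ.ket)).map (fun q => (2 * Real.pi * ħ) • q) := by
  ext B hB
  have hB' := measurable_const_smul (2 * Real.pi * ħ) hB
  rw [ρ.outcome_apply _ hB, ρ.ofReal_tr (POVM.pos _ _ hB), Measure.map_apply
    (measurable_const_smul _) hB, sumSqMeasure, Measure.sum_apply _ hB']
  refine tsum_congr fun j => ?_
  rw [Function.comp_apply, ← ofReal_re_inner_mulOp_indicator hB']
  congr 2
  exact POVM.inner_symm_right (fourierL2 n) _ _

lemma sumSqMeasure_univ (ρ : State (Hil n)) : sumSqMeasure ρ.ket Set.univ = 1 := by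
  rw [sumSqMeasure, Measure.sum_apply _ MeasurableSet.univ]
  simp only [sqMeasure_univ]
  exact ρ.tsum_enorm_ket

lemma sumSqMeasure_fourierL2_univ (ρ : State (Hil n)) :
    sumSqMeasure (fourierL2 n ∘ ρ.ket) Set.univ = 1 := by
  rw [sumSqMeasure, Measure.sum_apply _ MeasurableSet.univ]
  simp only [sqMeasure_univ, Function.comp_apply]
  rw [← ρ.tsum_enorm_ket]
  refine tsum_congr fun k => ?_
  rw [← ofReal_norm, ← ofReal_norm, LinearIsometryEquiv.norm_map]

instance (ρ : State (Hil n)) : IsProbabilityMeasure (sumSqMeasure ρ.ket) := ⟨sumSqMeasure_univ ρ⟩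

instance (ρ : State (Hil n)) : IsProbabilityMeasure (sumSqMeasure (fourierL2 n ∘ ρ.ket)) :=
  ⟨sumSqMeasure_fourierL2_univ ρ⟩

end QMeas

/-! ### Characteristic functions and the uncertainty inequality -/

namespace QMeas

open Matrix ProbabilityTheory

variable {n : ℕ} {ħ : ℝ}

lemma charFun_sqMeasure (u : Hil n) (k : Cfg n) :
    charFun (sqMeasure u) k = inner ℂ u (modul ((2 * Real.pi)⁻¹ • k) u) := by
  have hu := measurable_hil u
  rw [charFun_apply, sqMeasure, integral_withDensity_eq_integral_toReal_smul (by fun_prop)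
    (ae_of_all _ fun y => ENNReal.pow_lt_top enorm_lt_top), L2.inner_def]
  refine integral_congr_ae ?_
  filter_upwards [modul_coe ((2 * Real.pi)⁻¹ • k) u] with y hy
  rw [hy, RCLike.inner_apply, mul_assoc, Complex.mul_conj', real_inner_smul_left,
    mul_inv_cancel_left₀ (by positivity), real_inner_comm, ENNReal.toReal_pow, toReal_enorm,
    Complex.real_smul, mul_comm]
  norm_cast

lemma hasSum_charFun_sumSqMeasure {ι : Type*} (r : ι → Hil n) [IsFiniteMeasure (sumSqMeasure r)]
    (k : Cfg n) : HasSum (fun j => inner ℂ (r j) (modul ((2 * Real.pi)⁻¹ • k) (r j)))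
      (charFun (sumSqMeasure r) k) := by
  simp only [← charFun_sqMeasure, charFun_apply]
  have hf : IsFiniteMeasure (Measure.sum fun j => sqMeasure (r j)) :=
    ‹IsFiniteMeasure (sumSqMeasure r)›
  exact hasSum_integral_measure (Integrable.of_bound (C := 1) (by fun_prop)
    (ae_of_all _ fun y => (Complex.norm_exp_ofReal_mul_I _).le))

lemma transl_zero (ψ : Hil n) : transl 0 ψ = ψ := by
  refine Lp.ext ?_
  filter_upwards [transl_coe 0 ψ] with y hy
  rw [hy, sub_zero]

lemma modul_zero (ψ : Hil n) : modul 0 ψ = ψ := by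
  refine Lp.ext ?_
  filter_upwards [modul_coe 0 ψ] with y hy
  rw [hy]
  simp

lemma weyl_zero_left (hħ : ħ ≠ 0) (k : Cfg n) (ψ : Hil n) :
    weyl ħ (-(ħ • (0 : Cfg n))) (ħ • k) ψ = modul ((2 * Real.pi)⁻¹ • k) ψ := by
  rw [smul_zero, neg_zero, weyl_eq_modul_transl hħ, transl_zero, smul_smul, mul_inv,
    inv_mul_cancel_right₀ hħ]
  simp

lemma weyl_zero_right (hħ : ħ ≠ 0) (l : Cfg n) (ψ : Hil n) :
    weyl ħ (-(ħ • l)) (ħ • (0 : Cfg n)) ψ = transl (-(ħ • l)) ψ := by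
  rw [smul_zero, weyl_eq_modul_transl hħ, smul_zero, modul_zero]
  simp

/-- At $l=0$ the Weyl operator is a pure modulation, whose expectation is the classical
characteristic function of $|\psi|^2$. Likewise $k=0$ leaves a translation, which the Fourier
transform makes a modulation. -/
lemma charFun_outcome_posObs (hħ : ħ ≠ 0) (ρ : State (Hil n)) (k : Cfg n) :
    charFun (ρ.outcome (posObs n)) k = charFn ħ ρ k 0 := by
  have h := ρ.hasSum_tr_mul (weyl ħ (-(ħ • (0 : Cfg n))) (ħ • k))
  simp only [weyl_zero_left hħ] at h
  rw [ρ.outcome_posObs, charFn]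
  exact (hasSum_charFun_sumSqMeasure ρ.ket k).unique h

lemma charFun_outcome_momObs (hħ : ħ ≠ 0) (ρ : State (Hil n)) (l : Cfg n) :
    charFun (ρ.outcome (momObs ħ n)) l = charFn ħ ρ 0 l := by
  have h := ρ.hasSum_tr_mul (weyl ħ (-(ħ • l)) (ħ • (0 : Cfg n)))
  simp only [weyl_zero_right hħ] at h
  rw [ρ.outcome_momObs, charFun_map_smul, charFn]
  refine (hasSum_charFun_sumSqMeasure (fourierL2 n ∘ ρ.ket) _).unique ?_
  convert h using 1
  funext j
  rw [← (fourierL2 n).inner_map_map (ρ.sqrtOp _), fourierL2_transl, neg_neg, smul_smul,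
    inv_mul_cancel_left₀ (by positivity)]
  rfl

instance (ρ : State (Hil n)) : IsProbabilityMeasure (ρ.outcome (posObs n)) := by
  rw [ρ.outcome_posObs]
  infer_instance

instance (ρ : State (Hil n)) : IsProbabilityMeasure (ρ.outcome (momObs ħ n)) := by
  rw [ρ.outcome_momObs]
  exact Measure.isProbabilityMeasure_map (by fun_prop)

lemma State.outcome_covObs_fst_eq_conv (hħ : 0 < ħ) (ρ σ : State (Hil n)) :
    ρ.outcome ((covObs ħ σ).map Prod.fst measurable_fst) =
      ρ.outcome (posObs n) ∗ σ.outcome (posObs n) := by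
  rw [outcome_covObs_fst hħ, outcome_posObs, outcome_posObs]

lemma State.outcome_covObs_snd_eq_conv (hħ : 0 < ħ) (ρ σ : State (Hil n)) :
    ρ.outcome ((covObs ħ σ).map Prod.snd measurable_snd) =
      ρ.outcome (momObs ħ n) ∗ σ.outcome (momObs ħ n) := by
  rw [outcome_covObs_snd hħ, outcome_momObs, outcome_momObs]
  -- The dilation from frequency to momentum is linear, so it commutes with convolution.
  exact Measure.map_conv_continuousLinearMap
    ((2 * Real.pi * ħ) • ContinuousLinearMap.id ℝ (Cfg n))

section Uncertainty

open scoped ComplexOrder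

lemma ofReal_mulVec (M : Matrix (Fin n) (Fin n) ℝ) (u : Fin n → ℝ) :
    M.map Complex.ofReal *ᵥ (fun i => (u i : ℂ)) = fun i => (((M *ᵥ u) i : ℝ) : ℂ) := by
  funext i
  simp [mulVec, dotProduct]

lemma ofReal_dotProduct (u v : Fin n → ℝ) :
    (fun i => (u i : ℂ)) ⬝ᵥ (fun i => (v i : ℂ)) = ((u ⬝ᵥ v : ℝ) : ℂ) := by
  simp [dotProduct]

/-- The positivity of the complex variance matrix on the vectors `(α u, i β u)`. -/
lemma uncertainty_quadForm {A B C : Matrix (Fin n) (Fin n) ℝ}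
    (h : (fromBlocks (A.map Complex.ofReal)
      (C.map Complex.ofReal + (Complex.I * (ħ / 2)) • (1 : Matrix (Fin n) (Fin n) ℂ))
      (C.transpose.map Complex.ofReal - (Complex.I * (ħ / 2)) • (1 : Matrix (Fin n) (Fin n) ℂ))
      (B.map Complex.ofReal)).PosSemidef) (u : Fin n → ℝ) (α β : ℝ) :
    α * β * ħ * (u ⬝ᵥ u) ≤ α ^ 2 * (u ⬝ᵥ A *ᵥ u) + β ^ 2 * (u ⬝ᵥ B *ᵥ u) := by
  set cu : Fin n → ℂ := fun i => (u i : ℂ) with hcu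
  -- The contributions of $C$ and $C^T$ carry the factors $i\alpha\beta$ and $-i\alpha\beta$ and
  -- cancel, while the two $\hbar$ terms add up.
  have hC : u ⬝ᵥ Cᵀ *ᵥ u = u ⬝ᵥ C *ᵥ u := by
    rw [dotProduct_mulVec, vecMul_transpose, dotProduct_comm]
  have h1 := h.dotProduct_mulVec_nonneg (Sum.elim ((α : ℂ) • cu) ((Complex.I * β) • cu))
  have e : star (Sum.elim ((α : ℂ) • cu) ((Complex.I * β) • cu)) =
      Sum.elim ((α : ℂ) • cu) ((-Complex.I * β) • cu) := by
    funext i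
    rcases i with i | i <;> simp [hcu]
  rw [e, fromBlocks_mulVec, Sum.elim_comp_inl, Sum.elim_comp_inr] at h1
  rw [sumElim_dotProduct_sumElim] at h1
  simp only [add_mulVec, sub_mulVec, smul_mulVec, mulVec_smul, one_mulVec, smul_dotProduct,
    dotProduct_add, dotProduct_sub, dotProduct_smul, hcu, ofReal_mulVec, ofReal_dotProduct, hC,
    smul_eq_mul] at h1
  have e2 := (Complex.le_def.1 h1).1
  simp at e2
  nlinarith

/-- Fixing one of $\alpha,\beta$ at 1, the inequality bounds a nonzero linear function by a
quadratic one, so the quadratic coefficient must be positive. Hence neither distribution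
degenerates. -/
lemma posDef_of_uncertainty {A B C : Matrix (Fin n) (Fin n) ℝ} (hħ : 0 < ħ)
    (h : (fromBlocks (A.map Complex.ofReal)
      (C.map Complex.ofReal + (Complex.I * (ħ / 2)) • (1 : Matrix (Fin n) (Fin n) ℂ))
      (C.transpose.map Complex.ofReal - (Complex.I * (ħ / 2)) • (1 : Matrix (Fin n) (Fin n) ℂ))
      (B.map Complex.ofReal)).PosSemidef) : A.PosDef ∧ B.PosDef := by
  have hq := uncertainty_quadForm h
  have hH := isHermitian_fromBlocks_iff.1 h.1
  have hr : ∀ {M : Matrix (Fin n) (Fin n) ℝ}, (M.map Complex.ofReal).IsHermitian →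
      M.IsHermitian := fun {M} hM => by
    ext i j
    have := hM.apply i j
    simp at this
    simpa using this
  have hpos : ∀ u : Fin n → ℝ, u ≠ 0 → 0 < u ⬝ᵥ u := fun u hu => by
    simpa using dotProduct_star_self_pos_iff.2 hu
  have key : ∀ a b w : ℝ, 0 < w → (∀ α : ℝ, α * w ≤ α ^ 2 * a + b) → 0 < a := by
    intro a b w hw h1
    by_contra! ha
    -- With this $\alpha$ the left side is $|b|+1$, which exceeds $\alpha^2a+b$ when $a\le0$.
    have h2 := h1 ((|b| + 1) / w)
    rw [div_mul_cancel₀ _ hw.ne'] at h2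
    nlinarith [le_abs_self b, mul_nonneg (sq_nonneg ((|b| + 1) / w)) (neg_nonneg.2 ha)]
  refine ⟨.of_dotProduct_mulVec_pos (hr hH.1) fun u hu => ?_,
    .of_dotProduct_mulVec_pos (hr hH.2.2.2) fun u hu => ?_⟩
  · refine key _ (u ⬝ᵥ B *ᵥ u) _ (mul_pos hħ (hpos u hu)) fun α => ?_
    have := hq u α 1
    rw [star_trivial]
    linarith
  · refine key _ (u ⬝ᵥ A *ᵥ u) _ (mul_pos hħ (hpos u hu)) fun α => ?_
    have := hq u 1 α
    rw [star_trivial]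
    linarith

end Uncertainty

end QMeas

/-! ### Gaussian states and the error function -/

namespace QMeas

open Matrix ProbabilityTheory

variable {n : ℕ} {ħ : ℝ}

lemma eq_multivariateGaussian {μ : Measure (Cfg n)} [IsFiniteMeasure μ] (a : Fin n → ℝ)
    {A : Matrix (Fin n) (Fin n) ℝ} (hA : A.PosSemidef)
    (h : ∀ k : Cfg n, charFun μ k = Complex.exp (Complex.I * ((k ⬝ᵥ a : ℝ) : ℂ) -
      ((k ⬝ᵥ A *ᵥ k : ℝ) : ℂ) / 2)) : μ = multivariateGaussian (WithLp.toLp 2 a) A := by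
  refine Measure.ext_of_charFun (funext fun k => ?_)
  rw [h, charFun_multivariateGaussian hA, EuclideanSpace.inner_eq_star_dotProduct, star_trivial,
    dotProduct_comm a, mul_comm Complex.I]

lemma IsGaussian.exists_multivariateGaussian (hħ : 0 < ħ) {ρ : State (Hil n)}
    (hρ : IsGaussian ħ ρ) : ∃ (a b : Cfg n) (A B : Matrix (Fin n) (Fin n) ℝ),
      A.PosDef ∧ B.PosDef ∧ ρ.outcome (posObs n) = multivariateGaussian a A ∧
      ρ.outcome (momObs ħ n) = multivariateGaussian b B := by
  obtain ⟨a, b, A, B, C, hV, hc⟩ := hρ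
  obtain ⟨hA, hB⟩ := posDef_of_uncertainty hħ hV
  refine ⟨WithLp.toLp 2 a, WithLp.toLp 2 b, A, B, hA, hB,
    eq_multivariateGaussian a hA.posSemidef fun k => ?_,
    eq_multivariateGaussian b hB.posSemidef fun l => ?_⟩
  · rw [charFun_outcome_posObs hħ.ne', hc]
    simp
  · rw [charFun_outcome_momObs hħ.ne', hc]
    simp

lemma meanVec_multivariateGaussian (a : Cfg n) (A : Matrix (Fin n) (Fin n) ℝ) :
    meanVec (multivariateGaussian a A) = a.ofLp :=
  funext fun i => integral_coord a A i

lemma varMat_multivariateGaussian (a : Cfg n) {A : Matrix (Fin n) (Fin n) ℝ}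
    (hA : A.PosSemidef) : varMat (multivariateGaussian a A) = A := by
  ext i j
  rw [varMat, meanVec_multivariateGaussian, of_apply, integral_coord_mul_coord a a hA]
  simp

lemma conv_multivariateGaussian (a a' : Cfg n) {A A' : Matrix (Fin n) (Fin n) ℝ}
    (hA : A.PosSemidef) (hA' : A'.PosSemidef) :
    multivariateGaussian a A ∗ multivariateGaussian a' A' =
      multivariateGaussian (a + a') (A + A') := by
  refine Measure.ext_of_charFun (funext fun k => ?_)
  rw [charFun_conv, charFun_multivariateGaussian hA, charFun_multivariateGaussian hA',
    charFun_multivariateGaussian (hA.add hA'), ← Complex.exp_add, inner_add_right, add_mulVec,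
    dotProduct_add]
  congr 1
  push_cast
  ring

/-- The means differ by $-a'$, and the quadratic form ignores the sign; so only the mean of the
noise enters. -/
lemma relEntropy_multivariateGaussian (a a' : Cfg n) {A A' : Matrix (Fin n) (Fin n) ℝ}
    (hA : A.PosDef) (hA' : A'.PosDef) :
    relEntropy (multivariateGaussian a A) (multivariateGaussian (a + a') (A + A')) ≠ ⊤ ∧
    (relEntropy (multivariateGaussian a A) (multivariateGaussian (a + a') (A + A'))).toReal =
      Real.logb 2 (Real.exp 1) / 2 * ((Real.log ((A + A').det / A.det) - n +
        ((A + A')⁻¹ * A).trace) + a'.ofLp ⬝ᵥ (A + A')⁻¹ *ᵥ a'.ofLp) := by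
  obtain ⟨h1, h2⟩ := klDiv_multivariateGaussian a (a + a') hA (hA.add hA')
  refine ⟨ENNReal.mul_ne_top ENNReal.ofReal_ne_top h1, ?_⟩
  rw [relEntropy, ENNReal.toReal_mul, h2, ENNReal.toReal_ofReal
    (Real.logb_nonneg one_lt_two (Real.one_le_exp zero_le_one)), WithLp.ofLp_add,
    sub_add_cancel_left, mulVec_neg, dotProduct_neg, neg_dotProduct, neg_neg]
  ring

end QMeas

open QMeas in
theorem mainTheorem6 (n : ℕ) (ħ : ℝ) (hħ : 0 < ħ) (ρ σ : State (Hil n))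
    (hρ : IsGaussian ħ ρ) (hσ : IsGaussian ħ σ) :
    (errorFunction ħ ρ (covObs ħ σ) : EReal) =
      ((Real.logb 2 (Real.exp 1) / 2 *
        ((cfc sFun (congruence (posVar ρ) (posVar σ)) +
            cfc sFun (congruence (momVar ħ ρ) (momVar ħ σ))).trace
          + posMean σ ⬝ᵥ (posVar ρ + posVar σ)⁻¹.mulVec (posMean σ)
          + momMean ħ σ ⬝ᵥ (momVar ħ ρ + momVar ħ σ)⁻¹.mulVec (momMean ħ σ)) : ℝ) : EReal) ∧
    (errorFunction ħ ρ (covObs ħ σ) : EReal) =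
      ((Real.logb 2 (Real.exp 1) / 2 *
        ((cfc sFun (congruence (posVar σ) (posVar ρ))⁻¹ +
            cfc sFun (congruence (momVar ħ σ) (momVar ħ ρ))⁻¹).trace
          + posMean σ ⬝ᵥ (posVar ρ + posVar σ)⁻¹.mulVec (posMean σ)
          + momMean ħ σ ⬝ᵥ (momVar ħ ρ + momVar ħ σ)⁻¹.mulVec (momMean ħ σ)) : ℝ) : EReal) := by
  obtain ⟨a, b, A, B, hA, hB, hQ, hP⟩ := hρ.exists_multivariateGaussian hħ
  obtain ⟨a', b', A', B', hA', hB', hQ', hP'⟩ := hσ.exists_multivariateGaussian hħ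
  obtain ⟨h1, h2⟩ := relEntropy_multivariateGaussian a a' hA hA'
  obtain ⟨h3, h4⟩ := relEntropy_multivariateGaussian b b' hB hB'
  have e : errorFunction ħ ρ (covObs ħ σ) =
      relEntropy (ProbabilityTheory.multivariateGaussian a A)
        (ProbabilityTheory.multivariateGaussian (a + a') (A + A')) +
      relEntropy (ProbabilityTheory.multivariateGaussian b B)
        (ProbabilityTheory.multivariateGaussian (b + b') (B + B')) := by
    rw [errorFunction, State.outcome_covObs_fst_eq_conv hħ, State.outcome_covObs_snd_eq_conv hħ,
      hQ, hP, hQ', hP', conv_multivariateGaussian _ _ hA.posSemidef hA'.posSemidef,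
      conv_multivariateGaussian _ _ hB.posSemidef hB'.posSemidef]
  simp only [posMean, posVar, momMean, momVar, hQ, hP, hQ', hP', meanVec_multivariateGaussian,
    varMat_multivariateGaussian _ hA.posSemidef, varMat_multivariateGaussian _ hA'.posSemidef,
    varMat_multivariateGaussian _ hB.posSemidef, varMat_multivariateGaussian _ hB'.posSemidef]
  -- Finiteness of both entropies reduces the claim to an identity of real numbers. The trace lemmas
  -- bring both conjuncts to the same root-free form.
  rw [e, ← EReal.coe_ennreal_toReal (ENNReal.add_ne_top.2 ⟨h1, h3⟩), ENNReal.toReal_add h1 h3,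
    h2, h4, Matrix.trace_add, Matrix.trace_add, hA.trace_sFun_congruence hA',
    hB.trace_sFun_congruence hB', hA.trace_sFun_congruence_inv hA',
    hB.trace_sFun_congruence_inv hB', ← mul_add]
  constructor <;>
  · congr 2
    ring
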